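/- For $N\ge 2$ let $O_N^+$ be the free orthogonal quantum group, whose polynomial algebra $\mathcal O(O_N^+)$ is the universal unital $*$-algebra generated by self-adjoint elements $u_{ij}$ ($1\le i,j\le N$) such that $u=(u_{ij})$ satisfies $uu^t=u^tu=1$, and let $u$ act on $H_1=\mathbb C^N$. For $n\ge 0$ let $H_n\subseteq H_1^{\otimes n}$ be the space of the irreducible representation $u_n$ of $O_N^+$, i.e. of the constituent of $u^{\otimes n}$ that does not occur in $u^{\otimes j}$ for any $j<n$; equivalently, the set of vectors annihilated by every intertwiner from $u^{\otimes n}$ to $u^{\otimes j}$, $j<n$. Let $p_n$ be the orthogonal projection of $H_1^{\otimes n}$ onto $H_n$. Put $q=\frac{2}{N+\sqrt{N^2-4}}$, $[n]_q=q^{n-1}+q^{n-3}+\cdots+q^{-(n-1)}$ and $[n]_q!=[n]_q[n-1]_q\cdots[1]_q$, with $[0]_q!=1$. Let $T_{2r}:\mathbb C\to H_1^{\otimes 2r}$ be given by $1\mapsto\sum_{i_1,\dots,i_r=1}^N|i_1i_2\cdots i_r\rangle\otimes|i_r\cdots i_2i_1\rangle$. A triple $(l,m,k)$ of non-negative integers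 is admissible if $k\in\{|l-m|,|l-m|+2,\dots,l+m\}$; put then $r=\frac{l+m-k}{2}$ and $$\theta_q(k,l,m)=\frac{[r]_q!\,[l-r]_q!\,[m-r]_q!\,[k+r+1]_q!}{[l]_q!\,[m]_q!\,[k]_q!}.$$ Let $\alpha^{l,m}_k$ be the Stinespring operator of the $O_N^+$-Temperley–Lieb channel, $$\alpha^{l,m}_k=\sqrt{\frac{[k+1]_q}{\theta_q(k,l,m)}}\,(p_l\otimes p_m)(\mathrm{id}_{H_1^{\otimes(l-r)}}\otimes T_{2r}\otimes \mathrm{id}_{H_1^{\otimes(m-r)}}):H_k\to H_l\otimes H_m\subseteq H_1^{\otimes l}\otimes H_1^{\otimes m},$$ and let $$\gamma^{l,m}_k=N^{-r/2}\,(\mathrm{id}_{H_1^{\otimes(l-r)}}\otimes T_{2r}\otimes \mathrm{id}_{H_1^{\otimes(m-r)}}):H_k\to H_1^{\otimes l}\otimes H_1^{\otimes m}.$$ Theorem. For every admissible triple $(l,m,k)$, in operator norm, $$\|\alpha^{l,m}_k-\gamma^{l,m}_k\|=O(N^{-1})\qquad\text{as } N\to\infty,$$ where the implied constant may depend on $(l,m,k)$.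 -/

import Mathlib

open Filter Asymptotics
open scoped Kronecker Matrix

noncomputable section

namespace FreeOrthogonal

/-! ## The free orthogonal quantum group -/

/-- The defining relations of `O_N^+`: the matrix `u = (u_{ij})` of generators satisfies
`u uᵗ = 1` and `uᵗ u = 1`. -/
inductive OrthRel (N : ℕ) :
    FreeAlgebra ℂ (Fin N × Fin N) → FreeAlgebra ℂ (Fin N × Fin N) → Prop
  | mul_transpose (i j : Fin N) :
      OrthRel N (∑ s, FreeAlgebra.ι ℂ (i, s) * FreeAlgebra.ι ℂ (j, s)) (if i = j then 1 else 0)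
  | transpose_mul (i j : Fin N) :
      OrthRel N (∑ s, FreeAlgebra.ι ℂ (s, i) * FreeAlgebra.ι ℂ (s, j)) (if i = j then 1 else 0)

/-- The algebra `𝒪(O_N^+)` of polynomial functions on the free orthogonal quantum group: the
universal unital complex algebra generated by the entries `u_{ij}` of an orthogonal `N × N` matrix.
(The involution is the conjugate-linear anti-automorphism with `u_{ij}^* = u_{ij}`; it preserves
the relations, so it does not change the underlying algebra.) -/
abbrev PolyAlg (N : ℕ) : Type := RingQuot (OrthRel N)

/-- The fundamental representation `u = (u_{ij})` of `O_N^+` on `H_1 = ℂ^N`. -/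
def fundRep (N : ℕ) : Matrix (Fin N) (Fin N) (PolyAlg N) :=
  Matrix.of fun i j => RingQuot.mkAlgHom ℂ (OrthRel N) (FreeAlgebra.ι ℂ (i, j))

/-- The tensor power `u^{⊗ n}` on `H_1^{⊗ n}`, whose coefficient at the multi-indices `a`, `b` is
`u_{a_1 b_1} u_{a_2 b_2} ⋯ u_{a_n b_n}` (a product in this order). -/
def tensorRep (N n : ℕ) : Matrix (Fin n → Fin N) (Fin n → Fin N) (PolyAlg N) :=
  Matrix.of fun a b => (List.ofFn fun s : Fin n => fundRep N (a s) (b s)).prod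

/-- `T : H_1^{⊗ n} → H_1^{⊗ j}` intertwines the representations `u^{⊗ n}` and `u^{⊗ j}` of
`O_N^+`. -/
def IsIntertwiner {N n j : ℕ} (T : Matrix (Fin j → Fin N) (Fin n → Fin N) ℂ) : Prop :=
  T.map (algebraMap ℂ (PolyAlg N)) * tensorRep N n =
    tensorRep N j * T.map (algebraMap ℂ (PolyAlg N))

/-! ## The Hilbert spaces -/

/-- The Hilbert space `H_1^{⊗ n} = (ℂ^N)^{⊗ n}`, with the orthonormal basis
`|i_1 ⋯ i_n⟩` indexed by multi-indices. -/
abbrev TensorPow (N n : ℕ) : Type := EuclideanSpace ℂ (Fin n → Fin N)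

/-- The Hilbert space `H_1^{⊗ l} ⊗ H_1^{⊗ m}`, with the orthonormal basis
`|i_1 ⋯ i_l⟩ ⊗ |j_1 ⋯ j_m⟩`. -/
abbrev TensorPow₂ (N l m : ℕ) : Type := EuclideanSpace ℂ ((Fin l → Fin N) × (Fin m → Fin N))

/-- The space `H_n ⊆ H_1^{⊗ n}` of the irreducible representation `u_n` of `O_N^+`.
By definition `u_n` is the constituent of `u^{⊗ n}` that is new in this tensor power, that is,
the one that does not occur in `u^{⊗ j}` for any `j < n`. Its space is the largest
subrepresentation of `u^{⊗ n}` that has no constituent in common with the `u^{⊗ j}`, `j < n`: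
the set of vectors annihilated by every intertwiner from `u^{⊗ n}` to such a `u^{⊗ j}`. -/
def irrepSpace (N n : ℕ) : Submodule ℂ (TensorPow N n) :=
  ⨅ (j : ℕ) (_ : j < n) (T : Matrix (Fin j → Fin N) (Fin n → Fin N) ℂ) (_ : IsIntertwiner T),
    LinearMap.ker (Matrix.toEuclideanLin T)

/-- The orthogonal projection `p_n` of `H_1^{⊗ n}` onto `H_n`. -/
def proj (N n : ℕ) : TensorPow N n →L[ℂ] TensorPow N n :=
  (irrepSpace N n).starProjection

/-- The operator `A ⊗ B` on `H_1^{⊗ l} ⊗ H_1^{⊗ m}`; its matrix is the Kronecker product. -/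
def tensorOp {N l m : ℕ} (A : TensorPow N l →L[ℂ] TensorPow N l)
    (B : TensorPow N m →L[ℂ] TensorPow N m) : TensorPow₂ N l m →L[ℂ] TensorPow₂ N l m :=
  Matrix.toEuclideanCLM (𝕜 := ℂ)
    ((Matrix.toEuclideanCLM (𝕜 := ℂ)).symm A ⊗ₖ (Matrix.toEuclideanCLM (𝕜 := ℂ)).symm B)

/-! ## Admissible triples, quantum integers and the theta-net -/

/-- `(l, m, k)` is admissible: `k` is one of `|l - m|, |l - m| + 2, …, l + m`. -/
def IsAdmissible (l m k : ℕ) : Prop :=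
  ∃ i : ℕ, (k : ℤ) = |(l : ℤ) - (m : ℤ)| + 2 * (i : ℤ) ∧ k ≤ l + m

/-- `r = (l + m - k) / 2`; for admissible triples both operations are exact. -/
def capNumber (l m k : ℕ) : ℕ := (l + m - k) / 2

/-- The parameter `q = 2 / (N + √(N² - 4))`. -/
def qParam (N : ℕ) : ℝ := 2 / ((N : ℝ) + Real.sqrt ((N : ℝ) ^ 2 - 4))

/-- The quantum integer `[n]_q = q^{n-1} + q^{n-3} + ⋯ + q^{-(n-1)}`. -/
def qInt (N n : ℕ) : ℝ := ∑ i ∈ Finset.range n, qParam N ^ ((n : ℤ) - 1 - 2 * (i : ℤ))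

/-- The quantum factorial `[n]_q! = [n]_q [n-1]_q ⋯ [1]_q`, with `[0]_q! = 1`. -/
def qFactorial (N n : ℕ) : ℝ := ∏ i ∈ Finset.range n, qInt N (i + 1)

/-- The theta-net `θ_q(k, l, m)`. -/
def thetaNet (N k l m : ℕ) : ℝ :=
  (qFactorial N (capNumber l m k) * qFactorial N (l - capNumber l m k)
      * qFactorial N (m - capNumber l m k) * qFactorial N (k + capNumber l m k + 1))
    / (qFactorial N l * qFactorial N m * qFactorial N k)

/-! ## The two maps -/

open Classical in
/-- The matrix of `id_{l-r} ⊗ T_{2r} ⊗ id_{m-r} : H_1^{⊗ k} → H_1^{⊗ l} ⊗ H_1^{⊗ m}`, where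
`T_{2r} 1 = ∑ |i_1 ⋯ i_r⟩ ⊗ |i_r ⋯ i_1⟩`. The coefficient of `|x⟩ ⊗ |y⟩` in the image of `|z⟩`
is `1` if `x` starts with the first `l - r` entries of `z`, the last `r` entries of `x` are the
first `r` entries of `y` in reverse order, and `y` ends with the last `m - r` entries of `z`;
otherwise it is `0`. -/
def cupMatrix (N l m k : ℕ) :
    Matrix ((Fin l → Fin N) × (Fin m → Fin N)) (Fin k → Fin N) ℂ :=
  Matrix.of fun xy z =>
    if (∀ (s : Fin l) (t : Fin k), (s : ℕ) = t → (s : ℕ) < l - capNumber l m k →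
          xy.1 s = z t) ∧
       (∀ (s : Fin l) (t : Fin m), (s : ℕ) + t + 1 = l → (t : ℕ) < capNumber l m k →
          xy.1 s = xy.2 t) ∧
       (∀ (s : Fin m) (t : Fin k), (s : ℕ) + l = t + 2 * capNumber l m k →
          capNumber l m k ≤ (s : ℕ) → xy.2 s = z t)
    then 1 else 0

/-- `id_{l-r} ⊗ T_{2r} ⊗ id_{m-r}`, restricted to `H_k`. -/
def cupMap (N l m k : ℕ) : irrepSpace N k →L[ℂ] TensorPow₂ N l m :=
  (LinearMap.toContinuousLinearMap (Matrix.toEuclideanLin (cupMatrix N l m k))).comp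
    (irrepSpace N k).subtypeL

/-- The Stinespring isometry of the `O_N^+`-Temperley–Lieb channel,
`α^{l,m}_k = √([k+1]_q / θ_q(k,l,m)) (p_l ⊗ p_m) (id_{l-r} ⊗ T_{2r} ⊗ id_{m-r})`, as a map from
`H_k` to `H_l ⊗ H_m ⊆ H_1^{⊗ l} ⊗ H_1^{⊗ m}`. -/
def alpha (N l m k : ℕ) : irrepSpace N k →L[ℂ] TensorPow₂ N l m :=
  ((Real.sqrt (qInt N (k + 1) / thetaNet N k l m) : ℝ) : ℂ) •
    (tensorOp (proj N l) (proj N m)).comp (cupMap N l m k)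

/-- `γ^{l,m}_k = N^{-r/2} (id_{l-r} ⊗ T_{2r} ⊗ id_{m-r})`, as a map from `H_k` to
`H_1^{⊗ l} ⊗ H_1^{⊗ m}`. -/
def gamma (N l m k : ℕ) : irrepSpace N k →L[ℂ] TensorPow₂ N l m :=
  (((N : ℝ) ^ (-((capNumber l m k : ℝ) / 2)) : ℝ) : ℂ) • cupMap N l m k

end FreeOrthogonal

end

/-! Let `y` be the image of `x ∈ H_k` under the nested cups, `P = p_l ⊗ p_m`, and `s` the square
root in `alpha`. Then `α x - γ x = (s - N^{-r/2}) P y + N^{-r/2} (P y - y)`, and `‖P y‖ ≤ N^{r/2}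
‖x‖`. It therefore suffices that `s² N^r = 1 + O(1/N)` (`nearOne_scalar`) and `‖P y - y‖ =
O(N^{r/2-1}) ‖x‖` (`norm_tensorOp_cupVec_sub_le`). The former holds because `[n+1]_q = N^n (1 +
O(1/N))` and the leading powers of `N` match.

The latter rests on three facts. First, `H_n` is the common kernel of the caps `C_i` contracting
adjacent legs (`irrepSpace_eq_capKer`). Second, `A = ∑ C_i^* C_i` satisfies `‖A v‖² ≥ (N - 2) ⟨v, A
v⟩` by the Temperley–Lieb relations. This spectral gap bounds the squared distance of `v` to `H_n`
by `(N - 2)^{-1} ∑ ‖C_i v‖²`. Third, a cap inside one tensor factor of `y` either vanishes, since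
`x` is killed by caps, or leaves a vector of squared norm at most `N^{r-1} ‖x‖²`, one power of `N`
below the bound for `y`.

For the first fact, caps are intertwiners, so `H_n` lies in their kernel. The converse needs no
classification of intertwiners. The projections `Q_n` onto `highSpace N j n` commute with caps and
cups, so sending the coefficients of `u^{⊗ n}` to those of `Q_n` respects the defining relations.
Applied to an intertwiner `T` from `u^{⊗ n}` to `u^{⊗ j}`, this functional gives `T Q_n = Q_j T =
0`, while `Q_n` fixes the vectors killed by all caps when `j < n`. -/

noncomputable section

namespace FreeOrthogonal

/-! ## Insertion and deletion of two adjacent letters -/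

section Words

variable {α β : Type*} {n : ℕ}

/-- The word `w` with the letters `x`, `y` inserted at the positions `i`, `i + 1`. -/
def ins (i : Fin (n + 1)) (x y : α) (w : Fin n → α) : Fin (n + 2) → α := fun t =>
  if h : (t : ℕ) < i then w ⟨t, by omega⟩
  else if h₁ : (t : ℕ) = i then x
  else if h₂ : (t : ℕ) = i + 1 then y
  else w ⟨t - 2, by omega⟩

/-- The word `v` with the letters at the positions `i`, `i + 1` deleted. -/
def del (i : Fin (n + 1)) (v : Fin (n + 2) → α) : Fin n → α := fun t =>
  if (t : ℕ) < i then v ⟨t, by omega⟩ else v ⟨t + 2, by omega⟩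

lemma ins_castSucc (i : Fin (n + 1)) (x y : α) (w : Fin n → α) :
    ins i x y w i.castSucc = x := by
  simp [ins]

lemma ins_succ (i : Fin (n + 1)) (x y : α) (w : Fin n → α) :
    ins i x y w i.succ = y := by
  simp [ins]

lemma del_ins (i : Fin (n + 1)) (x y : α) (w : Fin n → α) : del i (ins i x y w) = w := by
  funext t
  simp only [del, ins]
  split_ifs <;> first | rfl | (exfalso; omega)

lemma ins_del (i : Fin (n + 1)) (v : Fin (n + 2) → α) :
    ins i (v i.castSucc) (v i.succ) (del i v) = v := by
  funext t
  simp only [del, ins]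
  split_ifs <;> first
    | rfl | (exfalso; omega)
    | exact congrArg v (Fin.ext (by simp only [Fin.val_castSucc, Fin.val_succ]; omega))

/-- A word of length `n + 2` amounts to its letters at the positions `i`, `i + 1` and to the
remaining word. -/
def insEquiv (i : Fin (n + 1)) : α × α × (Fin n → α) ≃ (Fin (n + 2) → α) where
  toFun p := ins i p.1 p.2.1 p.2.2
  invFun v := (v i.castSucc, v i.succ, del i v)
  left_inv p := by simp [ins_castSucc, ins_succ, del_ins]
  right_inv v := ins_del i v

lemma sum_ins [Fintype α] {M : Type*} [AddCommMonoid M] (i : Fin (n + 1))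
    (f : (Fin (n + 2) → α) → M) :
    ∑ v, f v = ∑ w, ∑ s, ∑ t, f (ins i s t w) := by
  rw [← (insEquiv i).sum_comp, ← (Equiv.prodAssoc α α _).sum_comp, Fintype.sum_prod_type_right]
  refine Finset.sum_congr rfl fun w _ => ?_
  rw [Fintype.sum_prod_type]
  rfl

lemma ins_ins_of_le (i k : Fin (n + 1)) (h : (i : ℕ) ≤ k) (s t : α) (w : Fin n → α) :
    ins (⟨k + 2, by omega⟩ : Fin (n + 2 + 1)) t t (ins i s s w)
      = ins (⟨i, by omega⟩ : Fin (n + 2 + 1)) s s (ins k t t w) := by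
  funext x
  simp only [ins]
  split_ifs <;> first
    | rfl | (exfalso; omega)

lemma ins_comp (f : α → β) (i : Fin (n + 1)) (x y : α) (w : Fin n → α) :
    (fun t => f (ins i x y w t)) = ins i (f x) (f y) (fun t => f (w t)) := by
  funext t
  simp only [ins]
  split_ifs <;> rfl

lemma ins_prod (i : Fin (n + 1)) (x y : α) (x' y' : β) (w : Fin n → α) (w' : Fin n → β) :
    (fun t => (ins i x y w t, ins i x' y' w' t))
      = ins i (x, x') (y, y') (fun t => (w t, w' t)) := by
  funext t
  simp only [ins]
  split_ifs <;> rfl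

/-- The bridge from inserting letters in words to inserting a pair of generators inside a monomial.
-/
lemma ofFn_ins (i : Fin (n + 1)) (x y : α) (w : Fin n → α) :
    List.ofFn (ins i x y w) = (List.ofFn w).take i ++ x :: y :: (List.ofFn w).drop i := by
  apply List.ext_getElem
  · simp; omega
  · intro t h1 h2
    have ht : t < n + 2 := by rwa [List.length_ofFn] at h1
    have hi : min (i : ℕ) n = i := by omega
    simp only [List.getElem_ofFn, ins, List.getElem_append, List.length_take, List.length_ofFn, hi,
      List.getElem_take]
    split_ifs with h3 h4 h5
    · rfl
    · subst h4; simp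
    · simp [h5]
    · obtain ⟨d, rfl⟩ : ∃ d, t = i + d + 2 := ⟨t - i - 2, by omega⟩
      have : (i : ℕ) + d + 2 - i = d + 2 := by omega
      simp [this, List.getElem_drop]

end Words

/-! ## Caps and cups -/

variable {N n : ℕ}

/-- The cap at the legs `i`, `i + 1`. -/
def cap (N : ℕ) {n : ℕ} (i : Fin (n + 1)) : TensorPow N (n + 2) →ₗ[ℂ] TensorPow N n where
  toFun v := WithLp.toLp 2 fun w => ∑ s, v (ins i s s w)
  map_add' v v' := by ext w; simp [Finset.sum_add_distrib]
  map_smul' c v := by ext w; simp [Finset.mul_sum]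

/-- The cup creating the legs `i`, `i + 1`. -/
def cup (N : ℕ) {n : ℕ} (i : Fin (n + 1)) : TensorPow N n →ₗ[ℂ] TensorPow N (n + 2) where
  toFun w := WithLp.toLp 2 fun v => if v i.castSucc = v i.succ then w (del i v) else 0
  map_add' v v' := by ext w; simp only [PiLp.add_apply]; split_ifs <;> simp
  map_smul' c v := by ext w; simp

lemma cap_apply (i : Fin (n + 1)) (v : TensorPow N (n + 2)) (w : Fin n → Fin N) :
    cap N i v w = ∑ s, v (ins i s s w) := rfl

lemma cup_apply (i : Fin (n + 1)) (w : TensorPow N n) (v : Fin (n + 2) → Fin N) :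
    cup N i w v = if v i.castSucc = v i.succ then w (del i v) else 0 := rfl

lemma cup_ins (i : Fin (n + 1)) (x : TensorPow N n) (s t : Fin N) (w : Fin n → Fin N) :
    cup N i x (ins i s t w) = if s = t then x w else 0 := by
  rw [cup_apply, ins_castSucc, ins_succ, del_ins]

lemma inner_cup_left (i : Fin (n + 1)) (x : TensorPow N n) (y : TensorPow N (n + 2)) :
    inner ℂ (cup N i x) y = inner ℂ x (cap N i y) := by
  simp only [PiLp.inner_apply]
  rw [sum_ins i]
  refine Finset.sum_congr rfl fun w _ => ?_
  simp only [cup_ins, cap_apply, inner_sum]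
  refine Finset.sum_congr rfl fun s _ => ?_
  rw [Finset.sum_eq_single s] <;> simp +contextual [eq_comm]

lemma inner_cap_left (i : Fin (n + 1)) (x : TensorPow N (n + 2)) (y : TensorPow N n) :
    inner ℂ (cap N i x) y = inner ℂ x (cup N i y) := by
  rw [← inner_conj_symm, ← inner_cup_left, inner_conj_symm]

lemma cap_cup_self (i : Fin (n + 1)) (x : TensorPow N n) : cap N i (cup N i x) = (N : ℂ) • x := by
  ext w
  simp [cap_apply, cup_ins]

/-- Zigzag relation: the cap joins one leg of the cup to a neighbouring leg, and the strand
straightens. -/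
lemma cap_cup_succ (i k : Fin (n + 1)) (h : (k : ℕ) = i + 1) (x : TensorPow N n) :
    cap N i (cup N k x) = x := by
  ext w
  have key : ∀ s, cup N k x (ins i s s w) = if s = w ⟨i, by omega⟩ then x w else 0 := by
    intro s
    have h1 : ins i s s w k.castSucc = s := by simp [ins, h]
    have h2 : ins i s s w k.succ = w ⟨i, by omega⟩ := by
      simp only [ins, Fin.val_succ, h]
      split_ifs <;> first | (exfalso; omega) | rfl
    rw [cup_apply, h1, h2]
    split_ifs with h3
    · refine congrArg x (funext fun t => ?_)
      simp only [del, ins]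
      split_ifs <;> first
        | rfl | exact h3.trans (congrArg w (Fin.ext (by simp only; omega))) | (exfalso; omega)
    · rfl
  simp [cap_apply, key]

lemma cap_cup_pred (i k : Fin (n + 1)) (h : (i : ℕ) = k + 1) (x : TensorPow N n) :
    cap N i (cup N k x) = x := by
  ext w
  have key : ∀ s, cup N k x (ins i s s w) = if s = w ⟨k, by omega⟩ then x w else 0 := by
    intro s
    have h1 : ins i s s w k.castSucc = w ⟨k, by omega⟩ := by simp [ins, h]
    have h2 : ins i s s w k.succ = s := by simp [ins, h]
    rw [cup_apply, h1, h2]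
    simp only [eq_comm (a := s)]
    split_ifs with h3
    · refine congrArg x (funext fun t => ?_)
      subst h3
      simp only [del, ins]
      split_ifs <;> first
        | rfl | (exfalso; omega)
        | exact congrArg w (Fin.ext (by simp only; omega))
    · rfl
  simp [cap_apply, key]

/-- A cap and a cup on disjoint pairs of legs commute; the shift by 2 accounts for the two legs that
the cap removes. -/
lemma cap_cup_of_le (i k : Fin (n + 1)) (h : (i : ℕ) ≤ k) (x : TensorPow N (n + 2)) :
    cap N (⟨i, by omega⟩ : Fin (n + 2 + 1)) (cup N (⟨k + 2, by omega⟩ : Fin (n + 2 + 1)) x)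
      = cup N k (cap N i x) := by
  ext w
  rw [cap_apply, cup_apply, cap_apply]
  have h1 : ∀ s, ins (⟨i, by omega⟩ : Fin (n + 2 + 1)) s s w
      (⟨k + 2, by omega⟩ : Fin (n + 2 + 1)).castSucc = w k.castSucc := by
    intro s
    simp only [ins, Fin.castSucc_mk]
    split_ifs <;> first | (exfalso; omega) | rfl
  have h2 : ∀ s, ins (⟨i, by omega⟩ : Fin (n + 2 + 1)) s s w
      (⟨k + 2, by omega⟩ : Fin (n + 2 + 1)).succ = w k.succ := by
    intro s
    simp only [ins, Fin.succ_mk]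
    split_ifs <;> first | (exfalso; omega) | (congr 1)
  simp only [cup_apply, h1, h2]
  split_ifs with h3
  · refine Finset.sum_congr rfl fun s _ => ?_
    refine congrArg x (funext fun t => ?_)
    simp only [del, ins]
    split_ifs <;> first
        | rfl | (exfalso; omega)
        | exact congrArg w (Fin.ext (by simp only; omega))
  · simp

lemma cap_cup_of_ge (i k : Fin (n + 1)) (h : (k : ℕ) ≤ i) (x : TensorPow N (n + 2)) :
    cap N (⟨i + 2, by omega⟩ : Fin (n + 2 + 1)) (cup N (⟨k, by omega⟩ : Fin (n + 2 + 1)) x)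
      = cup N k (cap N i x) := by
  ext w
  rw [cap_apply, cup_apply, cap_apply]
  have h1 : ∀ s, ins (⟨i + 2, by omega⟩ : Fin (n + 2 + 1)) s s w
      (⟨k, by omega⟩ : Fin (n + 2 + 1)).castSucc = w k.castSucc := by
    intro s
    simp only [ins, Fin.castSucc_mk]
    split_ifs <;> first | (exfalso; omega) | rfl
  have h2 : ∀ s, ins (⟨i + 2, by omega⟩ : Fin (n + 2 + 1)) s s w
      (⟨k, by omega⟩ : Fin (n + 2 + 1)).succ = w k.succ := by
    intro s
    simp only [ins, Fin.succ_mk]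
    split_ifs <;> first | (exfalso; omega) | (congr 1)
  simp only [cup_apply, h1, h2]
  split_ifs with h3
  · refine Finset.sum_congr rfl fun s _ => ?_
    refine congrArg x (funext fun t => ?_)
    simp only [del, ins]
    split_ifs <;> first
        | rfl | (exfalso; omega)
        | exact congrArg w (Fin.ext (by simp only; omega))
  · simp

lemma cap_cap_of_le (i k : Fin (n + 1)) (h : (i : ℕ) ≤ k) (x : TensorPow N (n + 4)) :
    cap N k (cap N (⟨i, by omega⟩ : Fin (n + 2 + 1)) x)
      = cap N i (cap N (⟨k + 2, by omega⟩ : Fin (n + 2 + 1)) x) := by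
  ext w
  simp only [cap_apply]
  rw [Finset.sum_comm]
  simp_rw [ins_ins_of_le i k h]

/-- The vectors annihilated by all caps. -/
def capKer (N : ℕ) : ∀ n : ℕ, Submodule ℂ (TensorPow N n)
  | 0 => ⊤
  | 1 => ⊤
  | _ + 2 => ⨅ i, LinearMap.ker (cap N i)

lemma mem_capKer {v : TensorPow N (n + 2)} : v ∈ capKer N (n + 2) ↔ ∀ i, cap N i v = 0 := by
  simp [capKer]

/-! ## A functional on the polynomial algebra -/

/-- The vectors of `H_1^{⊗ n}` all of whose iterated contractions to the tensor powers
`H_1^{⊗ j'}`, `j' ≤ j`, vanish. -/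
def highSpace (N j : ℕ) : ∀ n : ℕ, Submodule ℂ (TensorPow N n)
  | 0 => ⊥
  | 1 => if 1 ≤ j then ⊥ else ⊤
  | n + 2 => if n + 2 ≤ j then ⊥ else ⨅ i, (highSpace N j n).comap (cap N i)

lemma highSpace_of_le {j : ℕ} (h : n ≤ j) : highSpace N j n = ⊥ := by
  match n with
  | 0 => rfl
  | 1 => simp [highSpace, h]
  | n + 2 => simp [highSpace, h]

lemma mem_highSpace_of_lt {j : ℕ} (h : j < n + 2) {v : TensorPow N (n + 2)} :
    v ∈ highSpace N j (n + 2) ↔ ∀ i, cap N i v ∈ highSpace N j n := by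
  simp [highSpace, not_le.mpr h]

lemma cap_mem_highSpace {j : ℕ} {v : TensorPow N (n + 2)} (hv : v ∈ highSpace N j (n + 2))
    (i : Fin (n + 1)) : cap N i v ∈ highSpace N j n := by
  rcases le_or_gt (n + 2) j with h | h
  · rw [highSpace_of_le h, Submodule.mem_bot] at hv
    simp [hv]
  · exact (mem_highSpace_of_lt h).1 hv i

/-- By the Temperley–Lieb relations a cap of `cup w` is a multiple of `w`, or `w` itself, or a cup
of a cap of `w`. The last case drops two legs, whence the strong induction. -/
lemma cup_mem_highSpace (j : ℕ) : ∀ (n : ℕ) {w : TensorPow N n}, w ∈ highSpace N j n →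
    ∀ k : Fin (n + 1), cup N k w ∈ highSpace N j (n + 2) := by
  intro n
  induction n using Nat.strong_induction_on with
  | _ n ih =>
    intro w hw k
    rcases le_or_gt n j with h | h
    · rw [highSpace_of_le h, Submodule.mem_bot] at hw
      simp [hw]
    rw [mem_highSpace_of_lt (by omega)]
    intro i
    rcases lt_trichotomy (i : ℕ) k with hik | hik | hik
    · rcases Nat.lt_or_ge (i + 1) k with h1 | h1
      · obtain ⟨n, rfl⟩ : ∃ n', n = n' + 2 := ⟨n - 2, by omega⟩
        have := ih n (by omega) (cap_mem_highSpace hw ⟨i, by omega⟩) ⟨k - 2, by omega⟩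
        rw [← cap_cup_of_le ⟨i, by omega⟩ ⟨k - 2, by omega⟩ (by simp only; omega)] at this
        have hk : (⟨(k : ℕ) - 2 + 2, by omega⟩ : Fin (n + 2 + 1)) = k :=
          Fin.ext (by simp only; omega)
        simpa only [hk, Fin.eta] using this
      · rw [cap_cup_succ i k (by omega)]; exact hw
    · rw [Fin.ext hik, cap_cup_self]
      exact Submodule.smul_mem _ _ hw
    · rcases Nat.lt_or_ge (k + 1) i with h1 | h1
      · obtain ⟨n, rfl⟩ : ∃ n', n = n' + 2 := ⟨n - 2, by omega⟩
        have := ih n (by omega) (cap_mem_highSpace hw ⟨i - 2, by omega⟩) ⟨k, by omega⟩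
        rw [← cap_cup_of_ge ⟨i - 2, by omega⟩ ⟨k, by omega⟩ (by simp only; omega)] at this
        have hi : (⟨(i : ℕ) - 2 + 2, by omega⟩ : Fin (n + 2 + 1)) = i :=
          Fin.ext (by simp only; omega)
        simpa only [hi, Fin.eta] using this
      · rw [cap_cup_pred i k (by omega)]; exact hw

lemma capKer_le_highSpace {j : ℕ} (h : j < n) : capKer N n ≤ highSpace N j n := by
  match n with
  | 0 => omega
  | 1 => simp [highSpace, not_le.mpr h]
  | n + 2 =>
    intro v hv
    rw [mem_highSpace_of_lt h]
    intro i
    rw [mem_capKer.1 hv i]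
    exact zero_mem _

/-- The orthogonal projection onto `highSpace N j n`. -/
def highProj (N j n : ℕ) : TensorPow N n →L[ℂ] TensorPow N n := (highSpace N j n).starProjection

/-- Cups preserve `highSpace`; they preserve its orthogonal complement as well, because their
adjoints, the caps, preserve `highSpace`. -/
lemma highProj_cup (j : ℕ) (i : Fin (n + 1)) (x : TensorPow N n) :
    highProj N j (n + 2) (cup N i x) = cup N i (highProj N j n x) := by
  refine Submodule.eq_starProjection_of_mem_orthogonal
    (cup_mem_highSpace j n (Submodule.starProjection_apply_mem _ _) i) ?_
  rw [← map_sub, Submodule.mem_orthogonal']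
  intro y hy
  rw [inner_cup_left]
  exact Submodule.starProjection_inner_eq_zero _ _ (cap_mem_highSpace hy i)

lemma cap_highProj (j : ℕ) (i : Fin (n + 1)) (x : TensorPow N (n + 2)) :
    cap N i (highProj N j (n + 2) x) = highProj N j n (cap N i x) := by
  refine ext_inner_right ℂ fun y => ?_
  rw [inner_cap_left, highProj, highProj, Submodule.inner_starProjection_left_eq_right,
    Submodule.inner_starProjection_left_eq_right, inner_cap_left, ← highProj, ← highProj,
    highProj_cup]

/-- The matrix coefficients of `highProj N j n`. -/
def highCoeff (N j n : ℕ) (a b : Fin n → Fin N) : ℂ :=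
  highProj N j n (EuclideanSpace.single b 1) a

lemma cup_single (i : Fin (n + 1)) (b : Fin n → Fin N) :
    cup N i (EuclideanSpace.single b 1) = ∑ s, EuclideanSpace.single (ins i s s b) 1 := by
  ext v
  obtain ⟨⟨s, t, w⟩, rfl⟩ := (insEquiv i).surjective v
  change cup N i _ (ins i s t w) = _
  have key : ∀ s', ins i s t w = ins i s' s' b ↔ (s = s' ∧ t = s' ∧ w = b) := fun s' =>
    ((insEquiv i).injective.eq_iff (a := (s, t, w)) (b := (s', s', b))).trans (by simp)
  rw [cup_ins]
  simp only [insEquiv, Equiv.coe_fn_mk, WithLp.ofLp_sum, Finset.sum_apply, PiLp.single_apply, key]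
  by_cases h : s = t
  · subst h
    rw [Finset.sum_eq_single s] <;> simp +contextual [eq_comm]
  · rw [if_neg h, Finset.sum_eq_zero]
    rintro s' -
    rw [if_neg]
    rintro ⟨rfl, rfl, -⟩
    exact h rfl

lemma cap_single (i : Fin (n + 1)) (s t : Fin N) (b : Fin n → Fin N) :
    cap N i (EuclideanSpace.single (ins i s t b) 1)
      = if s = t then EuclideanSpace.single b 1 else 0 := by
  ext w
  have key : ∀ s', ins i s' s' w = ins i s t b ↔ (s' = s ∧ s' = t ∧ w = b) := fun s' =>
    ((insEquiv i).injective.eq_iff (a := (s', s', w)) (b := (s, t, b))).trans (by simp)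
  simp only [cap_apply, PiLp.single_apply, key]
  by_cases h : s = t
  · subst h
    rw [Finset.sum_eq_single s] <;> simp +contextual 
  · rw [if_neg h, Finset.sum_eq_zero]
    · rfl
    rintro s' -
    rw [if_neg]
    rintro ⟨rfl, rfl, -⟩
    exact h rfl

/-- The relation `u uᵗ = 1`, inserted at an arbitrary place of a monomial, holds for the
coefficients of `highProj` because it commutes with cups. The companion below is `uᵗ u = 1`, from
caps. -/
lemma sum_highCoeff_ins_right (j : ℕ) (i : Fin (n + 1)) (x y : Fin N) (a b : Fin n → Fin N) :
    ∑ s, highCoeff N j (n + 2) (ins i x y a) (ins i s s b)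
      = if x = y then highCoeff N j n a b else 0 := by
  have := congrArg (fun v : TensorPow N (n + 2) => v (ins i x y a))
    (highProj_cup j i (EuclideanSpace.single b 1))
  simpa [cup_single, cup_ins, highCoeff] using this

lemma sum_highCoeff_ins_left (j : ℕ) (i : Fin (n + 1)) (x y : Fin N) (a b : Fin n → Fin N) :
    ∑ s, highCoeff N j (n + 2) (ins i s s a) (ins i x y b)
      = if x = y then highCoeff N j n a b else 0 := by
  have := congrArg (fun v : TensorPow N n => v a)
    (cap_highProj j i (EuclideanSpace.single (ins i x y b) 1))
  simp only [cap_apply, cap_single] at this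
  rw [highCoeff]
  simp only [highCoeff, this]
  split_ifs <;> simp

/-! ### Descent of the coefficients to the quotient algebra -/

/-- The monomial of a word in the generators. -/
def mon {X : Type*} (L : List X) : FreeAlgebra ℂ X := (L.map (FreeAlgebra.ι ℂ)).prod

lemma basisFreeMonoid_apply {X : Type*} (L : FreeMonoid X) :
    FreeAlgebra.basisFreeMonoid ℂ X L = mon L.toList := by
  simp [FreeAlgebra.basisFreeMonoid, FreeAlgebra.equivMonoidAlgebraFreeMonoid, mon,
    FreeMonoid.lift_apply]

/-- The linear functional on the free algebra that sends the coefficients of `u^{⊗ n}` to the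
coefficients of `highProj N j n`. -/
def highFun (N j : ℕ) : FreeAlgebra ℂ (Fin N × Fin N) →ₗ[ℂ] ℂ :=
  (FreeAlgebra.basisFreeMonoid ℂ (Fin N × Fin N)).constr ℂ fun L =>
    highCoeff N j L.toList.length (fun i => (L.toList.get i).1) (fun i => (L.toList.get i).2)

lemma highFun_mon (j : ℕ) (L : List (Fin N × Fin N)) :
    highFun N j (mon L)
      = highCoeff N j L.length (fun i => (L.get i).1) (fun i => (L.get i).2) := by
  have := (FreeAlgebra.basisFreeMonoid ℂ (Fin N × Fin N)).constr_basis ℂ (fun L =>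
    highCoeff N j L.toList.length (fun i => (L.toList.get i).1) (fun i => (L.toList.get i).2))
    (FreeMonoid.ofList L)
  rwa [basisFreeMonoid_apply] at this

lemma highFun_mon_ofFn (j : ℕ) (w : Fin n → Fin N × Fin N) :
    highFun N j (mon (List.ofFn w)) = highCoeff N j n (fun i => (w i).1) (fun i => (w i).2) := by
  -- The list is generalized so that its length can be substituted, which avoids transporting
  -- `highCoeff` along an equality of lengths.
  have key : ∀ L : List (Fin N × Fin N), ∀ h : L.length = n, (∀ i : Fin n, L.get (i.cast h.symm) = w i) →
      highFun N j (mon L) = highCoeff N j n (fun i => (w i).1) (fun i => (w i).2) := by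
    rintro L rfl h
    rw [highFun_mon]
    simp only [← h]
    rfl
  exact key _ (by simp) (by simp)

lemma mon_append {X : Type*} (L L' : List X) : mon (L ++ L') = mon L * mon L' := by
  simp [mon]

lemma highFun_mul_pair_mul (j : ℕ) (p q : List (Fin N × Fin N)) :
    ∃ (n : ℕ) (i : Fin (n + 1)) (a b : Fin n → Fin N),
      highFun N j (mon p * mon q) = highCoeff N j n a b ∧
      ∀ x y : Fin N × Fin N,
        highFun N j (mon p * (FreeAlgebra.ι ℂ x * FreeAlgebra.ι ℂ y) * mon q)
          = highCoeff N j (n + 2) (ins i x.1 y.1 a) (ins i x.2 y.2 b) := by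
  obtain ⟨w, hw⟩ : ∃ w : Fin (p ++ q).length → Fin N × Fin N, List.ofFn w = p ++ q :=
    ⟨(p ++ q).get, List.ofFn_get _⟩
  refine ⟨_, ⟨p.length, by simp⟩, fun i => (w i).1, fun i => (w i).2, ?_, fun x y => ?_⟩
  · rw [← highFun_mon_ofFn, hw, mon_append]
  · have h := ofFn_ins ⟨p.length, by simp⟩ x y w
    have h' : mon p * (FreeAlgebra.ι ℂ x * FreeAlgebra.ι ℂ y) * mon q
        = mon (List.ofFn (ins ⟨p.length, by simp⟩ x y w)) := by
      rw [h, hw]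
      simp [mon, mul_assoc]
    rw [h', highFun_mon_ofFn, ins_comp, ins_comp]

lemma highFun_mul_rel_mul (j : ℕ) {x y : FreeAlgebra ℂ (Fin N × Fin N)} (h : OrthRel N x y)
    (p q : List (Fin N × Fin N)) :
    highFun N j (mon p * x * mon q) = highFun N j (mon p * y * mon q) := by
  cases h with
  | mul_transpose i k =>
    obtain ⟨n, t, a, b, h1, h2⟩ := highFun_mul_pair_mul j p q
    simp only [Finset.mul_sum, Finset.sum_mul, map_sum, h2, sum_highCoeff_ins_right]
    split_ifs <;> simp [h1]
  | transpose_mul i k =>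
    obtain ⟨n, t, a, b, h1, h2⟩ := highFun_mul_pair_mul j p q
    simp only [Finset.mul_sum, Finset.sum_mul, map_sum, h2, sum_highCoeff_ins_left]
    split_ifs <;> simp [h1]

lemma linearMap_congr_of_mon {X : Type*} {f g : FreeAlgebra ℂ X →ₗ[ℂ] ℂ}
    (h : ∀ L, f (mon L) = g (mon L)) : f = g :=
  (FreeAlgebra.basisFreeMonoid ℂ X).ext fun L => by
    rw [basisFreeMonoid_apply]; exact h _

/-- Both sides are linear in `p` and in `q`, and monomials span; extend first in `q`, then in `p`.
-/
lemma highFun_mul_rel_mul' (j : ℕ) {x y : FreeAlgebra ℂ (Fin N × Fin N)} (h : OrthRel N x y)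
    (p q : FreeAlgebra ℂ (Fin N × Fin N)) :
    highFun N j (p * x * q) = highFun N j (p * y * q) := by
  have h1 : ∀ p : List (Fin N × Fin N), highFun N j (mon p * x * q) = highFun N j (mon p * y * q) :=
    fun p => LinearMap.congr_fun (linearMap_congr_of_mon
      (f := highFun N j ∘ₗ LinearMap.mulLeft ℂ (mon p * x))
      (g := highFun N j ∘ₗ LinearMap.mulLeft ℂ (mon p * y)) (highFun_mul_rel_mul j h p)) q
  have h2 := LinearMap.congr_fun (linearMap_congr_of_mon
      (f := highFun N j ∘ₗ LinearMap.mulRight ℂ (x * q))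
      (g := highFun N j ∘ₗ LinearMap.mulRight ℂ (y * q))
      (fun p => by simpa [mul_assoc] using h1 p)) p
  simpa [mul_assoc] using h2

/-- The congruence of the elements that `highFun N j` does not distinguish, even after
multiplication from both sides. -/
def highCon (N j : ℕ) : RingCon (FreeAlgebra ℂ (Fin N × Fin N)) where
  r x y := ∀ p q, highFun N j (p * x * q) = highFun N j (p * y * q)
  iseqv := ⟨fun _ _ _ => rfl, fun h p q => (h p q).symm, fun h h' p q => (h p q).trans (h' p q)⟩
  add' h h' p q := by simp [mul_add, add_mul, h p q, h' p q]
  mul' {w x y z} h h' p q := by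
    have h1 := h p (y * q)
    have h2 := h' (p * x) q
    simp only [mul_assoc] at h1 h2 ⊢
    rw [h1, h2]

/-- The quotient by `highCon` satisfies the defining relations, so equality in `PolyAlg` implies
congruence; the factors `p = q = 1` recover the values of the functional. -/
lemma highFun_congr (j : ℕ) {x y : FreeAlgebra ℂ (Fin N × Fin N)}
    (h : RingQuot.mkAlgHom ℂ (OrthRel N) x = RingQuot.mkAlgHom ℂ (OrthRel N) y) :
    highFun N j x = highFun N j y := by
  have h' : RingQuot.mkRingHom (OrthRel N) x = RingQuot.mkRingHom (OrthRel N) y := by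
    rw [← RingQuot.mkAlgHom_coe ℂ]; exact h
  have hr : ∀ ⦃x y⦄, OrthRel N x y → (highCon N j).mk' x = (highCon N j).mk' y := fun x y hxy =>
    (RingCon.eq _).2 (highFun_mul_rel_mul' j hxy)
  have := congrArg (RingQuot.lift ⟨(highCon N j).mk', hr⟩) h'
  rw [RingQuot.lift_mkRingHom_apply, RingQuot.lift_mkRingHom_apply] at this
  simpa using (RingCon.eq _).1 this 1 1

/-! ## Identification of the space of the irreducible representation -/

/-- The word of pairs of the coefficient of `u^{⊗ n}` at `a`, `b`. -/
def pairs (a b : Fin n → Fin N) : List (Fin N × Fin N) := List.ofFn fun s => (a s, b s)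

lemma tensorRep_apply (a b : Fin n → Fin N) :
    tensorRep N n a b = RingQuot.mkAlgHom ℂ (OrthRel N) (mon (pairs a b)) := by
  simp only [tensorRep, Matrix.of_apply, mon, pairs, map_list_prod, List.map_ofFn]
  rfl

/-- Apply `highFun N j` to the intertwining relation entry by entry: it becomes `T Q_n = Q_j T`, and
`v = Q_n v`. -/
lemma capKer_le_irrepSpace : capKer N n ≤ irrepSpace N n := by
  intro v hv
  simp only [irrepSpace, Submodule.mem_iInf, LinearMap.mem_ker]
  intro j hj T hT
  have hv' : highProj N j n v = v :=
    Submodule.starProjection_eq_self_iff.2 (capKer_le_highSpace hj hv)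
  have key : ∀ a c, ∑ b, T a b * highCoeff N j n b c = 0 := by
    intro a c
    have h := congrFun (congrFun hT a) c
    have h' : RingQuot.mkAlgHom ℂ (OrthRel N) (∑ b, T a b • mon (pairs b c))
        = RingQuot.mkAlgHom ℂ (OrthRel N) (∑ b, T b c • mon (pairs a b)) := by
      simp only [Matrix.mul_apply, Matrix.map_apply, tensorRep_apply] at h
      simp only [← Algebra.smul_def, ← Algebra.commutes] at h
      simp only [map_sum, map_smul]
      exact h
    have h2 := highFun_congr j h'
    simp only [map_sum, map_smul, pairs, highFun_mon_ofFn, smul_eq_mul] at h2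
    rw [h2]
    refine Finset.sum_eq_zero fun b _ => ?_
    -- The right-hand side vanishes since `highSpace N j j` is zero.
    simp [highCoeff, highProj, highSpace_of_le le_rfl]
  have hsum : v = ∑ c, v c • EuclideanSpace.single c (1 : ℂ) := by
    ext b; simp [Pi.single_apply]
  ext a
  rw [← hv']
  have hP : ∀ b, highProj N j n v b = ∑ c, v c * highCoeff N j n b c := by
    intro b
    conv_lhs => rw [hsum]
    simp [highCoeff]
  simp only [Matrix.toLpLin_apply, Matrix.mulVec, dotProduct, hP, PiLp.zero_apply, Finset.mul_sum]
  rw [Finset.sum_comm]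
  refine Finset.sum_eq_zero fun c _ => ?_
  have := key a c
  calc _ = v c * ∑ b, T a b * highCoeff N j n b c := by
        rw [Finset.mul_sum]; exact Finset.sum_congr rfl fun b _ => by ring
    _ = 0 := by rw [this, mul_zero]

/-- The matrix of `cap N i`. -/
def capMatrix (N : ℕ) (i : Fin (n + 1)) : Matrix (Fin n → Fin N) (Fin (n + 2) → Fin N) ℂ :=
  Matrix.of fun w v => if v i.castSucc = v i.succ ∧ del i v = w then 1 else 0

lemma capMatrix_ins (i : Fin (n + 1)) (s t : Fin N) (w w' : Fin n → Fin N) :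
    capMatrix N i w (ins i s t w') = if s = t ∧ w' = w then 1 else 0 := by
  simp [capMatrix, ins_castSucc, ins_succ, del_ins]

lemma toEuclideanLin_capMatrix (i : Fin (n + 1)) (v : TensorPow N (n + 2)) :
    Matrix.toEuclideanLin (capMatrix N i) v = cap N i v := by
  ext w
  simp only [Matrix.toLpLin_apply, Matrix.mulVec, dotProduct, cap_apply]
  rw [sum_ins i]
  simp only [capMatrix_ins]
  rw [Finset.sum_eq_single w (fun w' _ h => by simp [h]) (by simp)]
  simp

lemma sum_fundRep_mul (x y : Fin N) :
    ∑ s, fundRep N s x * fundRep N s y = if x = y then 1 else 0 := by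
  have := RingQuot.mkAlgHom_rel ℂ (OrthRel.transpose_mul (N := N) x y)
  rw [map_sum] at this
  simp only [map_mul, apply_ite (RingQuot.mkAlgHom ℂ (OrthRel N)), map_one, map_zero] at this
  exact this

lemma exists_tensorRep_ins (i : Fin (n + 1)) (a b : Fin n → Fin N) :
    ∃ p q : PolyAlg N, tensorRep N n a b = p * q ∧ ∀ s t x y,
      tensorRep N (n + 2) (ins i s t a) (ins i x y b)
        = p * (fundRep N s x * fundRep N t y) * q := by
  refine ⟨RingQuot.mkAlgHom ℂ (OrthRel N) (mon ((pairs a b).take i)),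
    RingQuot.mkAlgHom ℂ (OrthRel N) (mon ((pairs a b).drop i)), ?_, fun s t x y => ?_⟩
  · rw [← map_mul, ← mon_append, List.take_append_drop, tensorRep_apply]
  · have : pairs (ins i s t a) (ins i x y b)
        = (pairs a b).take i ++ (s, x) :: (t, y) :: (pairs a b).drop i := by
      rw [pairs, ins_prod, ofFn_ins]
      rfl
    rw [tensorRep_apply, this, mon_append, map_mul, mul_assoc, mul_assoc]
    simp [mon, fundRep]

lemma isIntertwiner_capMatrix (i : Fin (n + 1)) : IsIntertwiner (capMatrix N i) := by
  refine Matrix.ext fun w v => ?_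
  obtain ⟨⟨x, y, b⟩, rfl⟩ := (insEquiv i).surjective v
  simp only [insEquiv, Equiv.coe_fn_mk]
  obtain ⟨p, q, h1, h2⟩ := exists_tensorRep_ins i w b
  rw [Matrix.mul_apply, Matrix.mul_apply, sum_ins i,
    Finset.sum_eq_single w (fun w' _ h => by simp [capMatrix_ins, h]) (by simp),
    Finset.sum_eq_single b (fun w' _ h => by simp [capMatrix_ins, h.symm]) (by simp)]
  simp only [Matrix.map_apply, capMatrix_ins, and_true, h1]
  have : ∀ s, ∑ t, algebraMap ℂ (PolyAlg N) (if s = t then 1 else 0)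
      * tensorRep N (n + 2) (ins i s t w) (ins i x y b) = p * (fundRep N s x * fundRep N s y) * q := by
    intro s
    rw [Finset.sum_eq_single s (fun t _ h => by simp [h.symm]) (by simp), h2]
    simp
  simp only [this]
  rw [← Finset.sum_mul, ← Finset.mul_sum, sum_fundRep_mul]
  split_ifs <;> simp

/-- The space `H_n` consists of the vectors annihilated by all caps. -/
theorem irrepSpace_eq_capKer : irrepSpace N n = capKer N n := by
  refine le_antisymm ?_ capKer_le_irrepSpace
  match n with
  | 0 => exact le_top
  | 1 => exact le_top
  | n + 2 =>
    intro v hv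
    rw [mem_capKer]
    intro i
    simp only [irrepSpace, Submodule.mem_iInf, LinearMap.mem_ker] at hv
    rw [← toEuclideanLin_capMatrix]
    exact hv n (by omega) _ (isIntertwiner_capMatrix i)

/-! ## The distance to the space of the irreducible representation -/

/-- The sum of the squares of the norms of all contractions of a vector. -/
def capEnergy (v : TensorPow N (n + 2)) : ℝ := ∑ i, ‖cap N i v‖ ^ 2

/-- The operator whose quadratic form is `capEnergy`. -/
def capHam (N n : ℕ) : TensorPow N (n + 2) →ₗ[ℂ] TensorPow N (n + 2) :=
  ∑ i, cup N i ∘ₗ cap N i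

lemma capHam_apply (v : TensorPow N (n + 2)) : capHam N n v = ∑ i, cup N i (cap N i v) := by
  simp [capHam]

lemma inner_capHam (v w : TensorPow N (n + 2)) :
    inner ℂ v (capHam N n w) = ∑ i, inner ℂ (cap N i v) (cap N i w) := by
  simp only [capHam_apply, inner_sum, inner_cap_left]

/-- Equal positions give the loop value `N`. Adjacent ones give `⟨C_i v, C_k v⟩`, bounded below by
Cauchy–Schwarz and AM–GM. For distant ones the caps commute, and the term is the squared norm of a
double contraction, hence nonnegative. -/
lemma inner_cup_cap (i k : Fin (n + 1)) (v : TensorPow N (n + 2)) :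
    (if i = k then (N : ℝ) * ‖cap N i v‖ ^ 2 else 0)
      - (if (k : ℕ) = i + 1 ∨ (i : ℕ) = k + 1 then (‖cap N i v‖ ^ 2 + ‖cap N k v‖ ^ 2) / 2 else 0)
      ≤ RCLike.re (inner ℂ (cup N i (cap N i v)) (cup N k (cap N k v))) := by
  rw [inner_cup_left]
  have hadj : -((‖cap N i v‖ ^ 2 + ‖cap N k v‖ ^ 2) / 2)
      ≤ RCLike.re (inner ℂ (cap N i v) (cap N k v)) := by
    have h1 := abs_le.1 ((RCLike.abs_re_le_norm _).trans (norm_inner_le_norm (𝕜 := ℂ) (cap N i v) (cap N k v)))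
    nlinarith [sq_nonneg (‖cap N i v‖ - ‖cap N k v‖), h1.1]
  rcases lt_trichotomy (i : ℕ) k with hik | hik | hik
  · have hne : i ≠ k := fun h => by simp [h] at hik
    rcases Nat.lt_or_ge (i + 1) k with h1 | h1
    · rw [if_neg hne, if_neg (by omega), sub_zero]
      obtain ⟨n, rfl⟩ : ∃ n', n = n' + 2 := ⟨n - 2, by omega⟩
      have h2 := cap_cup_of_le ⟨i, by omega⟩ ⟨k - 2, by omega⟩ (by simp only; omega) (cap N k v)
      have h3 := cap_cap_of_le ⟨i, by omega⟩ ⟨k - 2, by omega⟩ (by simp only; omega) v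
      have hk : (⟨(k : ℕ) - 2 + 2, by omega⟩ : Fin (n + 2 + 1)) = k :=
        Fin.ext (by simp only; omega)
      simp only [hk, Fin.eta] at h2 h3
      rw [h2, ← inner_cap_left, h3]
      exact inner_self_nonneg
    · rw [if_neg hne, if_pos (by omega), cap_cup_succ i k (by omega), zero_sub]
      exact hadj
  · obtain rfl := Fin.ext hik
    rw [cap_cup_self, if_pos rfl, if_neg (by omega), sub_zero, inner_smul_right]
    have := RCLike.re_ofReal_mul (N : ℝ) (inner ℂ (cap N i v) (cap N i v))
    rw [inner_self_eq_norm_sq] at this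
    simpa using this.ge
  · have hne : i ≠ k := fun h => by simp [h] at hik
    rcases Nat.lt_or_ge (k + 1) i with h1 | h1
    · rw [if_neg hne, if_neg (by omega), sub_zero]
      obtain ⟨n, rfl⟩ : ∃ n', n = n' + 2 := ⟨n - 2, by omega⟩
      have h2 := cap_cup_of_ge ⟨i - 2, by omega⟩ ⟨k, by omega⟩ (by simp only; omega) (cap N k v)
      have h3 := cap_cap_of_le ⟨k, by omega⟩ ⟨i - 2, by omega⟩ (by simp only; omega) v
      have hk : (⟨(i : ℕ) - 2 + 2, by omega⟩ : Fin (n + 2 + 1)) = i :=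
        Fin.ext (by simp only; omega)
      simp only [hk, Fin.eta] at h2 h3
      rw [h2, ← inner_cap_left, ← h3]
      exact inner_self_nonneg
    · rw [if_neg hne, if_pos (by omega), cap_cup_pred i k (by omega), zero_sub]
      exact hadj

lemma sum_adjacent_le (f : Fin n → ℝ) (hf : ∀ i, 0 ≤ f i) :
    ∑ i : Fin n, ∑ k : Fin n, (if (k : ℕ) = i + 1 ∨ (i : ℕ) = k + 1 then f i else 0) ≤ 2 * ∑ i, f i := by
  rw [Finset.mul_sum]
  refine Finset.sum_le_sum fun i _ => ?_
  rw [← Finset.sum_filter, Finset.sum_const, nsmul_eq_mul]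
  refine mul_le_mul_of_nonneg_right ?_ (hf i)
  -- For `i = 0` the truncated `i - 1` only adds a superfluous element, which is harmless for an
  -- upper bound.
  have : (Finset.univ.filter fun k : Fin n => (k : ℕ) = i + 1 ∨ (i : ℕ) = k + 1).card
      ≤ ({(i : ℕ) + 1, (i : ℕ) - 1} : Finset ℕ).card := by
    refine Finset.card_le_card_of_injOn (fun k => (k : ℕ)) (fun k hk => ?_)
      (fun _ _ _ _ h => Fin.ext h)
    simp only [Finset.coe_filter, Finset.mem_univ, true_and, Set.mem_ofPred_eq] at hk
    simp only [Finset.coe_insert, Finset.coe_singleton, Set.mem_insert_iff, Set.mem_singleton_iff]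
    omega
  exact_mod_cast this.trans Finset.card_le_two

/-- The operator inequality `A² ≥ (N - 2) A` for `A = capHam N n`: the diagonal contributes `N`, and
each position loses at most 2 to its neighbours. -/
lemma mul_capEnergy_le (v : TensorPow N (n + 2)) :
    ((N : ℝ) - 2) * capEnergy v ≤ ‖capHam N n v‖ ^ 2 := by
  have h1 : ‖capHam N n v‖ ^ 2
      = ∑ i, ∑ k, RCLike.re (inner ℂ (cup N i (cap N i v)) (cup N k (cap N k v))) := by
    rw [← inner_self_eq_norm_sq (𝕜 := ℂ), capHam_apply, sum_inner, map_sum]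
    simp only [inner_sum, map_sum]
  rw [h1]
  refine le_trans ?_ (Finset.sum_le_sum fun i _ => Finset.sum_le_sum fun k _ => inner_cup_cap i k v)
  simp only [Finset.sum_sub_distrib]
  have h2 := sum_adjacent_le (fun i => ‖cap N i v‖ ^ 2) (fun i => sq_nonneg _)
  have h3 : ∑ i : Fin (n + 1), ∑ k : Fin (n + 1),
      (if (k : ℕ) = i + 1 ∨ (i : ℕ) = k + 1 then (‖cap N i v‖ ^ 2 + ‖cap N k v‖ ^ 2) / 2 else 0)
      = ∑ i : Fin (n + 1), ∑ k : Fin (n + 1),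
        (if (k : ℕ) = i + 1 ∨ (i : ℕ) = k + 1 then ‖cap N i v‖ ^ 2 else 0) := by
    have h4 : ∑ i : Fin (n + 1), ∑ k : Fin (n + 1),
        (if (k : ℕ) = i + 1 ∨ (i : ℕ) = k + 1 then ‖cap N k v‖ ^ 2 / 2 else 0)
        = ∑ i : Fin (n + 1), ∑ k : Fin (n + 1),
        (if (k : ℕ) = i + 1 ∨ (i : ℕ) = k + 1 then ‖cap N i v‖ ^ 2 / 2 else 0) := by
      rw [Finset.sum_comm]
      simp only [or_comm]
    calc _ = ∑ i : Fin (n + 1), ∑ k : Fin (n + 1),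
        (if (k : ℕ) = i + 1 ∨ (i : ℕ) = k + 1 then ‖cap N i v‖ ^ 2 / 2 else 0)
        + ∑ i : Fin (n + 1), ∑ k : Fin (n + 1),
        (if (k : ℕ) = i + 1 ∨ (i : ℕ) = k + 1 then ‖cap N k v‖ ^ 2 / 2 else 0) := by
          simp only [← Finset.sum_add_distrib]
          refine Finset.sum_congr rfl fun i _ => Finset.sum_congr rfl fun k _ => ?_
          split_ifs <;> ring
      _ = _ := by
          rw [h4]
          simp only [← Finset.sum_add_distrib]
          refine Finset.sum_congr rfl fun i _ => Finset.sum_congr rfl fun k _ => ?_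
          split_ifs <;> ring
  rw [h3]
  simp only [Finset.sum_ite_eq, Finset.mem_univ, if_true, ← Finset.mul_sum]
  rw [capEnergy]
  linarith

lemma capEnergy_nonneg (v : TensorPow N (n + 2)) : 0 ≤ capEnergy v :=
  Finset.sum_nonneg fun _ _ => sq_nonneg _

lemma norm_inner_capHam_sq_le (v w : TensorPow N (n + 2)) :
    ‖inner ℂ v (capHam N n w)‖ ^ 2 ≤ capEnergy v * capEnergy w := by
  rw [inner_capHam]
  calc _ ≤ (∑ i, ‖cap N i v‖ * ‖cap N i w‖) ^ 2 := by
        gcongr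
        exact (norm_sum_le _ _).trans (Finset.sum_le_sum fun i _ => norm_inner_le_norm _ _)
    _ ≤ _ := Finset.sum_mul_sq_le_sq_mul_sq _ _ _

lemma ker_capHam : LinearMap.ker (capHam N n) = capKer N (n + 2) := by
  ext v
  rw [LinearMap.mem_ker, mem_capKer]
  constructor
  · intro h
    have h1 := inner_capHam v v
    rw [h, inner_zero_right] at h1
    have h2 := congrArg RCLike.re h1
    simp only [map_zero, map_sum, inner_self_eq_norm_sq] at h2
    intro i
    have := (Finset.sum_eq_zero_iff_of_nonneg (fun i _ => sq_nonneg _)).1 h2.symm i (Finset.mem_univ i)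
    simpa using this
  · intro h
    simp [capHam_apply, h]

lemma mem_range_capHam {v : TensorPow N (n + 2)} (hv : v ∈ (capKer N (n + 2))ᗮ) :
    ∃ w, capHam N n w = v := by
  have hs : (capHam N n).IsSymmetric := by
    intro x y
    rw [inner_capHam, ← inner_conj_symm, inner_capHam, map_sum]
    exact Finset.sum_congr rfl fun i _ => inner_conj_symm _ _
  rw [← ker_capHam, ← hs.orthogonal_range, Submodule.orthogonal_orthogonal] at hv
  exact hv

/-- A spectral gap: away from `H_n`, the energy controls the norm. -/
lemma norm_sq_le_capEnergy {v : TensorPow N (n + 2)} (hv : v ∈ (capKer N (n + 2))ᗮ) :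
    ((N : ℝ) - 2) * ‖v‖ ^ 2 ≤ capEnergy v := by
  obtain ⟨w, hw⟩ := mem_range_capHam hv
  have h1 := norm_inner_capHam_sq_le v w
  have h2 := mul_capEnergy_le w
  rw [hw] at h1 h2
  rw [inner_self_eq_norm_sq_to_K] at h1
  have h3 : ‖((‖v‖ : ℂ) ^ 2)‖ = ‖v‖ ^ 2 := by simp
  have h1' : (‖v‖ ^ 2) ^ 2 ≤ capEnergy v * capEnergy w := by rw [← h3]; exact h1
  have h4 := capEnergy_nonneg v
  have h5 := capEnergy_nonneg w
  rcases le_or_gt ((N : ℝ) - 2) 0 with hN | hN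
  · nlinarith [sq_nonneg ‖v‖]
  rcases eq_or_lt_of_le (sq_nonneg ‖v‖) with h0 | h0
  · rw [← h0]; simpa using h4
  -- With `v = A w`: `(N - 2) ‖v‖⁴ ≤ E(v) (N - 2) E(w) ≤ E(v) ‖A w‖² = E(v) ‖v‖²`, where `E` is
  -- `capEnergy`; then cancel `‖v‖²`.
  · have : ((N : ℝ) - 2) * (‖v‖ ^ 2) ^ 2 ≤ capEnergy v * ‖v‖ ^ 2 := by nlinarith
    nlinarith

/-- The caps kill the projection of `v`, so `v` and its component orthogonal to `H_n` have the same
energy. -/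
lemma norm_sub_starProjection_sq_le (v : TensorPow N (n + 2)) :
    ((N : ℝ) - 2) * ‖v - proj N (n + 2) v‖ ^ 2 ≤ capEnergy v := by
  have hmem : proj N (n + 2) v ∈ capKer N (n + 2) := by
    rw [← irrepSpace_eq_capKer]; exact Submodule.starProjection_apply_mem _ _
  have h1 : v - proj N (n + 2) v ∈ (capKer N (n + 2))ᗮ := by
    rw [← irrepSpace_eq_capKer]; exact Submodule.sub_starProjection_mem_orthogonal _
  refine (norm_sq_le_capEnergy h1).trans_eq ?_
  simp only [capEnergy, map_sub, mem_capKer.1 hmem, sub_zero]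

/-! ## The nested cups -/

section NestedCups

variable {α : Type*} {l m k r : ℕ}

/-- The last `r` letters of `p` are the first `r` letters of `q` in reverse order. -/
def Compat (r : ℕ) (p : Fin l → α) (q : Fin m → α) : Prop :=
  ∀ (s : Fin l) (t : Fin m), (s : ℕ) + t + 1 = l → (t : ℕ) < r → p s = q t

/-- The first `l - r` letters of `p`, followed by the last `m - r` letters of `q`. -/
def join (h : k + 2 * r = l + m) (p : Fin l → α) (q : Fin m → α) : Fin k → α := fun t =>
  if h' : (t : ℕ) + r < l then p ⟨t, by omega⟩ else q ⟨t + 2 * r - l, by omega⟩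

lemma eq_left_of_join_eq (h : k + 2 * r = l + m) (hm : r ≤ m) {p p' : Fin l → α} {q q' : Fin m → α}
    (hj : join h p q = join h p' q') (s : Fin l) (hs : (s : ℕ) + r < l) : p s = p' s := by
  simpa [join, hs] using congrFun hj ⟨s, by omega⟩

lemma eq_right_of_join_eq (h : k + 2 * r = l + m) (hl : r ≤ l) {p p' : Fin l → α} {q q' : Fin m → α}
    (hj : join h p q = join h p' q') (t : Fin m) (ht : r ≤ t) : q t = q' t := by
  have h1 := congrFun hj ⟨t + l - 2 * r, by omega⟩
  have h2 : ¬ ((t : ℕ) + l - 2 * r + r < l) := by omega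
  have h3 : (⟨(t : ℕ) + l - 2 * r + 2 * r - l, by omega⟩ : Fin m) = t := Fin.ext (by simp only; omega)
  simpa [join, h2, h3] using h1

lemma left_eq_of_join_eq (h : k + 2 * r = l + m) (hm : r ≤ m) {p p' : Fin l → α}
    {q : Fin m → α} (hc : Compat r p q) (hc' : Compat r p' q)
    (hj : join h p q = join h p' q) : p = p' := by
  funext s
  rcases lt_or_ge ((s : ℕ) + r) l with hs | hs
  · exact eq_left_of_join_eq h hm hj s hs
  · have hs' := s.2
    rw [hc s ⟨l - 1 - s, by omega⟩ (by simp only; omega) (by simp only; omega),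
      hc' s ⟨l - 1 - s, by omega⟩ (by simp only; omega) (by simp only; omega)]

lemma right_eq_of_join_eq (h : k + 2 * r = l + m) (hl : r ≤ l) {p : Fin l → α}
    {q q' : Fin m → α} (hc : Compat r p q) (hc' : Compat r p q')
    (hj : join h p q = join h p q') : q = q' := by
  funext t
  rcases lt_or_ge (t : ℕ) r with ht | ht
  · rw [← hc ⟨l - 1 - t, by omega⟩ t (by simp only; omega) ht,
      ← hc' ⟨l - 1 - t, by omega⟩ t (by simp only; omega) ht]
  · exact eq_right_of_join_eq h hl hj t ht

lemma compat_ins_left {m : ℕ} (i : Fin (n + 1)) (hi : (i : ℕ) + r < n + 1) (x y : α) (w : Fin n → α)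
    (q : Fin m → α) : Compat r (ins i x y w) q ↔ Compat r w q := by
  constructor
  · intro h s t hst ht
    rw [← h ⟨s + 2, by omega⟩ t (by simp only; omega) ht]
    simp only [ins]
    split_ifs <;> first | rfl | (exfalso; omega)
  · intro h s t hst ht
    rw [← h ⟨s - 2, by omega⟩ t (by simp only; omega) ht]
    simp only [ins]
    split_ifs <;> first | rfl | (exfalso; omega)

lemma compat_ins_right {l : ℕ} (i : Fin (n + 1)) (hi : r ≤ i) (x y : α) (p : Fin l → α)
    (w : Fin n → α) : Compat r p (ins i x y w) ↔ Compat r p w := by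
  constructor
  · intro h s t hst ht
    rw [h s ⟨t, by omega⟩ (by simp only; omega) ht]
    simp only [ins]
    split_ifs <;> first | rfl | (exfalso; omega)
  · intro h s t hst ht
    rw [h s ⟨t, by omega⟩ (by simp only; omega) ht]
    simp only [ins]
    split_ifs <;> first | rfl | (exfalso; omega)

lemma join_ins_left (h : k + 2 + 2 * r = n + 2 + m) (h' : k + 2 * r = n + m) (i : Fin (n + 1))
    (hk : (i : ℕ) < k + 1) (hi : (i : ℕ) + r < n + 1) (x y : α) (w : Fin n → α) (q : Fin m → α) :
    join h (ins i x y w) q = ins ⟨i, hk⟩ x y (join h' w q) := by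
  funext t
  simp only [join, ins]
  split_ifs <;> first
    | rfl | (exfalso; omega)
    | exact congrArg q (Fin.ext (by simp only; omega))

lemma join_ins_right (h : k + 2 + 2 * r = l + (n + 2)) (h' : k + 2 * r = l + n) (i : Fin (n + 1))
    (hk : (i : ℕ) + l - 2 * r < k + 1) (hl : r ≤ l) (hi : r ≤ i) (x y : α) (p : Fin l → α)
    (w : Fin n → α) :
    join h p (ins i x y w) = ins ⟨i + l - 2 * r, hk⟩ x y (join h' p w) := by
  funext t
  simp only [join, ins]
  split_ifs <;> first
    | rfl | (exfalso; omega)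
    | exact congrArg w (Fin.ext (by simp only; omega))

end NestedCups

variable {l m k r : ℕ}

open Classical in
lemma cupMatrix_apply (h : k + 2 * r = l + m) (hl : r ≤ l) (p : Fin l → Fin N)
    (q : Fin m → Fin N) (z : Fin k → Fin N) :
    cupMatrix N l m k (p, q) z = if Compat r p q ∧ join h p q = z then 1 else 0 := by
  have hr : capNumber l m k = r := by unfold capNumber; omega
  simp only [cupMatrix, Matrix.of_apply, hr]
  refine if_congr ?_ rfl rfl
  constructor
  · rintro ⟨h1, h2, h3⟩
    refine ⟨h2, funext fun t => ?_⟩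
    simp only [join]
    split_ifs with ht
    · exact h1 _ _ rfl (by simp only; omega)
    · exact h3 _ _ (by simp only; omega) (by simp only; omega)
  · rintro ⟨h2, rfl⟩
    refine ⟨fun s t hst hs => ?_, h2, fun s t hst hs => ?_⟩
    · rw [join, dif_pos (by omega)]
      exact congrArg p (Fin.ext hst)
    · rw [join, dif_neg (by omega)]
      exact congrArg q (Fin.ext (by simp only; omega))

open Classical in
lemma toEuclideanLin_cupMatrix_apply (h : k + 2 * r = l + m) (hl : r ≤ l) (x : TensorPow N k)
    (p : Fin l → Fin N) (q : Fin m → Fin N) :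
    Matrix.toEuclideanLin (cupMatrix N l m k) x (p, q)
      = if Compat r p q then x (join h p q) else 0 := by
  simp only [Matrix.toLpLin_apply, Matrix.mulVec, dotProduct, cupMatrix_apply h hl]
  rw [Finset.sum_eq_single (join h p q) (fun z _ hz => by simp [hz.symm]) (by simp)]
  simp

/-! ### Counting estimates for nested cups and their contractions -/

/-- Each `z` is hit at most `card R` times, the extra coordinate in `R` separating the points of a
fibre. Powers of `N` are counted by taking words of length `r` for `R`. -/
lemma sum_ite_le_card_mul_sum {A Z R : Type*} [Fintype A] [Fintype Z] [Fintype R]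
    (P : A → Prop) [DecidablePred P] (φ : A → Z × R) (hφ : Set.InjOn φ {a | P a}) (f : Z → ℝ)
    (hf : ∀ z, 0 ≤ f z) :
    ∑ a, (if P a then f (φ a).1 else 0) ≤ (Fintype.card R : ℝ) * ∑ z, f z := by
  classical
  have h1 : ∑ y : Z × R, f y.1 = (Fintype.card R : ℝ) * ∑ z, f z := by
    rw [Fintype.sum_prod_type, Finset.mul_sum]
    simp
  rw [← h1, ← Finset.sum_filter,
    ← Finset.sum_image (f := fun y : Z × R => f y.1) (g := φ) (by simpa using hφ)]
  exact Finset.sum_le_sum_of_subset_of_nonneg (Finset.subset_univ _) fun y _ _ => hf _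

lemma card_words (N r : ℕ) : (Fintype.card (Fin r → Fin N) : ℝ) = (N : ℝ) ^ r := by simp

open Classical in
lemma sum_norm_sq_cup_le (h : k + 2 * r = l + m) (hl : r ≤ l) (hm : r ≤ m) (x : TensorPow N k) :
    ∑ y : (Fin l → Fin N) × (Fin m → Fin N),
      ‖(if Compat r y.1 y.2 then x (join h y.1 y.2) else 0 : ℂ)‖ ^ 2 ≤ (N : ℝ) ^ r * ‖x‖ ^ 2 := by
  rw [EuclideanSpace.norm_sq_eq, ← card_words N r]
  refine le_trans (le_of_eq ?_) (sum_ite_le_card_mul_sum (fun y => Compat r y.1 y.2)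
    (fun y : (Fin l → Fin N) × (Fin m → Fin N) =>
      (join h y.1 y.2, fun t : Fin r => y.2 (t.castLE hm))) ?_ (fun z => ‖x z‖ ^ 2)
      (fun z => sq_nonneg _))
  · refine Finset.sum_congr rfl fun y _ => ?_
    split_ifs <;> simp
  · rintro ⟨p, q⟩ hc ⟨p', q'⟩ hc' heq
    simp only [Prod.mk.injEq] at heq
    obtain ⟨h1, h2⟩ := heq
    have hq : q = q' := by
      funext t
      rcases lt_or_ge (t : ℕ) r with ht | ht
      · exact congrFun h2 ⟨t, ht⟩
      · exact eq_right_of_join_eq h hl h1 t ht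
    subst hq
    exact congrArg (fun p => (p, q)) (left_eq_of_join_eq h hm hc hc' h1)

open Classical in
-- If both capped legs are legs of `x`, the contraction is zero. Otherwise the leg `i + 1` belongs
-- to a cup and the cap forces one letter of `q`; that letter is no longer free, which gains the
-- factor `N` on the left.
lemma sum_norm_sq_cap_left_le (h : k + 2 * r = n + 2 + m) (hl : r ≤ n + 2) (hm : r ≤ m)
    {x : TensorPow N k} (hx : x ∈ capKer N k) (i : Fin (n + 1)) :
    (N : ℝ) * ∑ q : Fin m → Fin N, ∑ w : Fin n → Fin N,
      ‖∑ s, (if Compat r (ins i s s w) q then x (join h (ins i s s w) q) else 0 : ℂ)‖ ^ 2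
      ≤ (N : ℝ) ^ r * ‖x‖ ^ 2 := by
  rcases lt_or_ge ((i : ℕ) + r) (n + 1) with hi | hi
  · obtain ⟨k, rfl⟩ : ∃ k', k = k' + 2 := ⟨k - 2, by omega⟩
    have h0 : ∀ (q : Fin m → Fin N) (w : Fin n → Fin N),
        ∑ s, (if Compat r (ins i s s w) q then x (join h (ins i s s w) q) else 0 : ℂ) = 0 := by
      intro q w
      simp only [compat_ins_left i hi, join_ins_left h (by omega) i (by omega) hi]
      split_ifs
      · rw [← cap_apply, mem_capKer.1 hx]; rfl
      · simp
    simp only [h0]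
    simp
    positivity
  · have hi' := i.2
    have ht0 : n - i < m := by omega
    -- The position in `q` of the letter that the cups pair with the leg `i + 1` of the left factor.
    set t0 : Fin m := ⟨n - i, ht0⟩ with ht0_def
    have h1 : ∀ (q : Fin m → Fin N) (w : Fin n → Fin N),
        ∑ s, (if Compat r (ins i s s w) q then x (join h (ins i s s w) q) else 0 : ℂ)
          = if Compat r (ins i (q t0) (q t0) w) q then x (join h (ins i (q t0) (q t0) w) q)
            else 0 := by
      intro q w
      refine Finset.sum_eq_single (q t0) (fun s _ hs => ?_) (by simp)
      rw [if_neg]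
      intro hc
      have := hc i.succ t0 (by simp only [Fin.val_succ, ht0_def]; omega) (by simp only [ht0_def]; omega)
      rw [ins_succ] at this
      exact hs this
    simp only [h1]
    rw [EuclideanSpace.norm_sq_eq, ← card_words N r]
    -- The factor `N` becomes a free letter `c`, stored in the slot `t0` of the code word. This
    -- stays injective because `q t0` is determined by the rest.
    refine le_trans (le_of_eq ?_) (sum_ite_le_card_mul_sum
      (fun y : (Fin m → Fin N) × (Fin n → Fin N) × Fin N =>
        Compat r (ins i (y.1 t0) (y.1 t0) y.2.1) y.1)
      (fun y => (join h (ins i (y.1 t0) (y.1 t0) y.2.1) y.1,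
        Function.update (fun t : Fin r => y.1 (t.castLE hm)) ⟨n - i, by omega⟩ y.2.2))
      ?_ (fun z => ‖x z‖ ^ 2) (fun z => sq_nonneg _))
    · rw [Fintype.sum_prod_type, Finset.mul_sum]
      refine Finset.sum_congr rfl fun q _ => ?_
      rw [Fintype.sum_prod_type, Finset.mul_sum]
      refine Finset.sum_congr rfl fun w _ => ?_
      split_ifs <;> simp
    · rintro ⟨q, w, c⟩ hc ⟨q', w', c'⟩ hc' heq
      simp only [Prod.mk.injEq] at heq
      obtain ⟨hj, hu⟩ := heq
      simp only [Set.mem_ofPred_eq] at hc hc'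
      have hcc : c = c' := by simpa using congrFun hu ⟨n - i, by omega⟩
      have hlow : ∀ t : Fin m, (t : ℕ) < r → t ≠ t0 → q t = q' t := by
        intro t ht hne
        have hne' : (⟨t, ht⟩ : Fin r) ≠ ⟨n - i, by omega⟩ := fun he =>
          hne (Fin.ext (by simpa using congrArg Fin.val he))
        have h2 := congrFun hu ⟨t, ht⟩
        rw [Function.update_of_ne hne', Function.update_of_ne hne'] at h2
        exact h2
      -- The leg `i` carries the same letter `q t0`. It is either a leg of `x`, read off from
      -- `join`, or the cup partner of the letter at `t0 + 1`.
      have ht0q : q t0 = q' t0 := by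
        rcases lt_or_ge ((i : ℕ) + r) (n + 2) with hir | hir
        · have h2 := eq_left_of_join_eq h hm hj i.castSucc hir
          rwa [ins_castSucc, ins_castSucc] at h2
        · have h2 := hc i.castSucc ⟨n - i + 1, by omega⟩ (by simp only [Fin.val_castSucc]; omega)
            (by simp only; omega)
          have h3 := hc' i.castSucc ⟨n - i + 1, by omega⟩ (by simp only [Fin.val_castSucc]; omega)
            (by simp only; omega)
          rw [ins_castSucc] at h2 h3
          rw [h2, h3]
          exact hlow _ (by simp only; omega) fun he => by
            have := congrArg Fin.val he
            simp [ht0_def] at this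
      have hq : q = q' := by
        funext t
        rcases lt_or_ge (t : ℕ) r with ht | ht
        · by_cases he : t = t0
          · rw [he, ht0q]
          · exact hlow t ht he
        · exact eq_right_of_join_eq h hl hj t ht
      subst hq
      have hw := congrArg (del i) (left_eq_of_join_eq h hm hc hc' hj)
      rw [del_ins, del_ins] at hw
      rw [hw, hcc]

open Classical in
lemma sum_norm_sq_cap_right_le (h : k + 2 * r = l + (n + 2)) (hl : r ≤ l) (hm : r ≤ n + 2)
    {x : TensorPow N k} (hx : x ∈ capKer N k) (i : Fin (n + 1)) :
    (N : ℝ) * ∑ p : Fin l → Fin N, ∑ w : Fin n → Fin N,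
      ‖∑ s, (if Compat r p (ins i s s w) then x (join h p (ins i s s w)) else 0 : ℂ)‖ ^ 2
      ≤ (N : ℝ) ^ r * ‖x‖ ^ 2 := by
  have hi' := i.2
  rcases le_or_gt r i with hi | hi
  · obtain ⟨k, rfl⟩ : ∃ k', k = k' + 2 := ⟨k - 2, by omega⟩
    have h0 : ∀ (p : Fin l → Fin N) (w : Fin n → Fin N),
        ∑ s, (if Compat r p (ins i s s w) then x (join h p (ins i s s w)) else 0 : ℂ) = 0 := by
      intro p w
      simp only [compat_ins_right i hi, join_ins_right h (by omega) i (by omega) hl hi]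
      split_ifs
      · rw [← cap_apply, mem_capKer.1 hx]; rfl
      · simp
    simp only [h0]
    simp
    positivity
  · have ht0 : l - 1 - i < l := by omega
    set t0 : Fin l := ⟨l - 1 - i, ht0⟩ with ht0_def
    have h1 : ∀ (p : Fin l → Fin N) (w : Fin n → Fin N),
        ∑ s, (if Compat r p (ins i s s w) then x (join h p (ins i s s w)) else 0 : ℂ)
          = if Compat r p (ins i (p t0) (p t0) w) then x (join h p (ins i (p t0) (p t0) w))
            else 0 := by
      intro p w
      refine Finset.sum_eq_single (p t0) (fun s _ hs => ?_) (by simp)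
      rw [if_neg]
      intro hc
      have := hc t0 i.castSucc (by simp only [Fin.val_castSucc, ht0_def]; omega) hi
      rw [ins_castSucc] at this
      exact hs this.symm
    simp only [h1]
    rw [EuclideanSpace.norm_sq_eq, ← card_words N r]
    refine le_trans (le_of_eq ?_) (sum_ite_le_card_mul_sum
      (fun y : (Fin l → Fin N) × (Fin n → Fin N) × Fin N =>
        Compat r y.1 (ins i (y.1 t0) (y.1 t0) y.2.1))
      (fun y => (join h y.1 (ins i (y.1 t0) (y.1 t0) y.2.1),
        Function.update (fun t : Fin r => y.1 ⟨l - 1 - t, by omega⟩) ⟨i, hi⟩ y.2.2))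
      ?_ (fun z => ‖x z‖ ^ 2) (fun z => sq_nonneg _))
    · rw [Fintype.sum_prod_type, Finset.mul_sum]
      refine Finset.sum_congr rfl fun q _ => ?_
      rw [Fintype.sum_prod_type, Finset.mul_sum]
      refine Finset.sum_congr rfl fun w _ => ?_
      split_ifs <;> simp
    · rintro ⟨p, w, c⟩ hc ⟨p', w', c'⟩ hc' heq
      simp only [Prod.mk.injEq] at heq
      obtain ⟨hj, hu⟩ := heq
      simp only [Set.mem_ofPred_eq] at hc hc'
      have hcc : c = c' := by simpa using congrFun hu ⟨i, hi⟩
      have hlow : ∀ t : Fin l, l ≤ (t : ℕ) + r → t ≠ t0 → p t = p' t := by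
        intro t ht hne
        have ht' := t.2
        have hne' : (⟨l - 1 - t, by omega⟩ : Fin r) ≠ ⟨i, hi⟩ := fun he =>
          hne (Fin.ext (by have := congrArg Fin.val he; simp only [ht0_def] at this ⊢; omega))
        have h2 := congrFun hu ⟨l - 1 - t, by omega⟩
        rw [Function.update_of_ne hne', Function.update_of_ne hne'] at h2
        have h3 : (⟨l - 1 - (l - 1 - t), by omega⟩ : Fin l) = t := Fin.ext (by simp only; omega)
        simpa only [h3] using h2
      have ht0p : p t0 = p' t0 := by
        rcases le_or_gt r ((i : ℕ) + 1) with hir | hir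
        · have h2 := eq_right_of_join_eq h hl hj i.succ (by simpa using hir)
          rwa [ins_succ, ins_succ] at h2
        · have h2 := hc ⟨l - 1 - (i + 1), by omega⟩ i.succ (by simp only [Fin.val_succ]; omega)
            (by simpa using hir)
          have h3 := hc' ⟨l - 1 - (i + 1), by omega⟩ i.succ (by simp only [Fin.val_succ]; omega)
            (by simpa using hir)
          rw [ins_succ] at h2 h3
          rw [← h2, ← h3]
          exact hlow _ (by simp only; omega) fun he => by
            have := congrArg Fin.val he
            simp only [ht0_def] at this
            omega
      have hp : p = p' := by
        funext t
        rcases lt_or_ge ((t : ℕ) + r) l with ht | ht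
        · exact eq_left_of_join_eq h hm hj t ht
        · by_cases he : t = t0
          · rw [he, ht0p]
          · exact hlow t ht he
      subst hp
      have hw := congrArg (del i) (right_eq_of_join_eq h hl hc hc' hj)
      rw [del_ins, del_ins] at hw
      rw [hw, hcc]

/-! ## Asymptotics of the scalar factor -/

/-- `f(N) = 1 + O(1/N)`. -/
def NearOne (f : ℕ → ℝ) : Prop := (fun N => f N - 1) =O[atTop] fun N : ℕ => (N : ℝ)⁻¹

lemma NearOne.tendsto {f : ℕ → ℝ} (hf : NearOne f) : Tendsto f atTop (nhds 1) := by
  have := (hf.trans_tendsto (tendsto_inv_atTop_nhds_zero_nat (𝕜 := ℝ))).add_const 1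
  simpa using this

lemma NearOne.one : NearOne fun _ => 1 := by
  simpa [NearOne] using isBigO_zero _ _

lemma NearOne.congr {f g : ℕ → ℝ} (hf : NearOne f) (h : f =ᶠ[atTop] g) : NearOne g :=
  IsBigO.congr' hf (h.mono fun N hN => by simp only [hN]) (EventuallyEq.refl _ _)

lemma NearOne.mul {f g : ℕ → ℝ} (hf : NearOne f) (hg : NearOne g) :
    NearOne fun N => f N * g N := by
  have h1 : (fun N => (f N - 1) * g N) =O[atTop] fun N : ℕ => (N : ℝ)⁻¹ := by
    simpa using IsBigO.mul hf (hg.tendsto.isBigO_one ℝ)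
  refine (h1.add hg).congr_left fun N => ?_
  ring

lemma NearOne.inv {f : ℕ → ℝ} (hf : NearOne f) : NearOne fun N => (f N)⁻¹ := by
  have h1 : (fun N => (f N - 1) * (f N)⁻¹) =O[atTop] fun N : ℕ => (N : ℝ)⁻¹ := by
    simpa using IsBigO.mul hf ((hf.tendsto.inv₀ one_ne_zero).isBigO_one ℝ)
  refine h1.neg_left.congr' ?_ (EventuallyEq.refl _ _)
  filter_upwards [hf.tendsto.eventually_ne one_ne_zero] with N hN
  field_simp
  ring

lemma NearOne.add {f g : ℕ → ℝ} (hf : NearOne f) (hg : g =O[atTop] fun N : ℕ => (N : ℝ)⁻¹) :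
    NearOne fun N => f N + g N :=
  (IsBigO.add hf hg).congr_left fun N => by ring

lemma NearOne.prod {f : ℕ → ℕ → ℝ} (n : ℕ) (hf : ∀ i, NearOne (f i)) :
    NearOne fun N => ∏ i ∈ Finset.range n, f i N := by
  induction n with
  | zero => simpa using NearOne.one
  | succ n ih => simpa only [Finset.prod_range_succ] using ih.mul (hf n)

lemma qParam_pos {N : ℕ} (hN : 2 ≤ N) : 0 < qParam N := by
  have : (2 : ℝ) ≤ N := by exact_mod_cast hN
  unfold qParam
  positivity

lemma inv_qParam_add {N : ℕ} (hN : 2 ≤ N) : (qParam N)⁻¹ + qParam N = N := by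
  have h2 : (2 : ℝ) ≤ N := by exact_mod_cast hN
  have h3 : Real.sqrt ((N : ℝ) ^ 2 - 4) ^ 2 = (N : ℝ) ^ 2 - 4 := Real.sq_sqrt (by nlinarith)
  have h4 : (N : ℝ) + Real.sqrt ((N : ℝ) ^ 2 - 4) ≠ 0 := by positivity
  unfold qParam
  field_simp
  nlinarith

lemma qParam_le_one {N : ℕ} (hN : 2 ≤ N) : qParam N ≤ 1 := by
  have h2 : (2 : ℝ) ≤ N := by exact_mod_cast hN
  unfold qParam
  have := Real.sqrt_nonneg ((N : ℝ) ^ 2 - 4)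
  rw [div_le_one (by positivity)]
  linarith

/-- From `q⁻¹ = N - q` with `0 < q ≤ 1`. -/
lemma nearOne_inv_qParam_div : NearOne fun N => (qParam N)⁻¹ / N := by
  refine IsBigO.of_bound 1 ?_
  filter_upwards [eventually_ge_atTop 2] with N hN
  have h2 : (2 : ℝ) ≤ N := by exact_mod_cast hN
  have h1 := inv_qParam_add hN
  have h3 : (qParam N)⁻¹ / N - 1 = -(qParam N * (N : ℝ)⁻¹) := by
    have : (qParam N)⁻¹ = N - qParam N := by linarith
    rw [this]
    field_simp
    ring
  rw [h3, norm_neg, norm_mul, Real.norm_of_nonneg (qParam_pos hN).le]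
  exact mul_le_mul_of_nonneg_right (qParam_le_one hN) (norm_nonneg _)

lemma qInt_one (N : ℕ) : qInt N 1 = 1 := by simp [qInt]

/-- Splitting off the top power `q^n` leaves `q⁻¹ [n]_q`; thus each step multiplies the leading term
by `N`. -/
lemma qInt_succ {N : ℕ} (hN : 2 ≤ N) (n : ℕ) :
    qInt N (n + 1) = (qParam N)⁻¹ * qInt N n + qParam N ^ n := by
  have h0 := (qParam_pos hN).ne'
  unfold qInt
  rw [Finset.sum_range_succ', Finset.mul_sum]
  congr 1
  · refine Finset.sum_congr rfl fun i _ => ?_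
    rw [← zpow_neg_one, ← zpow_add₀ h0]
    congr 1
    push_cast
    ring
  · rw [← zpow_natCast]
    congr 1
    push_cast
    ring

lemma nearOne_qInt (n : ℕ) : NearOne fun N => qInt N (n + 1) / (N : ℝ) ^ n := by
  induction n with
  | zero => simpa [qInt_one] using NearOne.one
  | succ n ih =>
    have h1 : (fun N => qParam N ^ (n + 1) / (N : ℝ) ^ (n + 1))
        =O[atTop] fun N : ℕ => (N : ℝ)⁻¹ := by
      refine IsBigO.of_bound 1 ?_
      filter_upwards [eventually_ge_atTop 2] with N hN
      have h2 : (1 : ℝ) ≤ N := by exact_mod_cast (by omega : 1 ≤ N)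
      have hq := (qParam_pos hN).le
      rw [Real.norm_of_nonneg (by positivity), Real.norm_of_nonneg (by positivity), one_mul,
        div_eq_mul_inv]
      calc _ ≤ 1 * ((N : ℝ) ^ (n + 1))⁻¹ := by
            gcongr
            exact pow_le_one₀ hq (qParam_le_one hN)
        _ ≤ _ := by
            rw [one_mul]
            gcongr
            exact le_self_pow₀ h2 (by omega)
    refine ((nearOne_inv_qParam_div.mul ih).add h1).congr ?_
    filter_upwards [eventually_ge_atTop 2] with N hN
    have h2 : (N : ℝ) ≠ 0 := by positivity
    rw [qInt_succ hN (n + 1), add_div, pow_succ' (N : ℝ) n, mul_div_mul_comm]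

/-- The exponent `n (n - 1) / 2` of the leading power of `N` in the quantum factorial. -/
def triNum (n : ℕ) : ℕ := ∑ i ∈ Finset.range n, i

lemma triNum_add (a b : ℕ) : triNum (a + b) = triNum a + triNum b + a * b := by
  induction b with
  | zero => simp [triNum]
  | succ b ih =>
    have h1 : triNum (a + b + 1) = triNum (a + b) + (a + b) := Finset.sum_range_succ _ _
    have h2 : triNum (b + 1) = triNum b + b := Finset.sum_range_succ _ _
    rw [← add_assoc, h1, ih, h2]
    ring

lemma nearOne_qFactorial (n : ℕ) : NearOne fun N => qFactorial N n / (N : ℝ) ^ triNum n := by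
  have := NearOne.prod n nearOne_qInt
  refine this.congr (Eventually.of_forall fun N => ?_)
  simp only [Finset.prod_div_distrib]
  rw [Finset.prod_pow_eq_pow_sum (Finset.range n) (fun i => i) (N : ℝ)]
  rfl

lemma nearOne_scalar {l m k r : ℕ} (h : k + 2 * r = l + m) (hl : r ≤ l) (hm : r ≤ m) :
    NearOne fun N => qInt N (k + 1) / thetaNet N k l m * (N : ℝ) ^ r := by
  obtain ⟨a, rfl⟩ := Nat.exists_eq_add_of_le' hl
  obtain ⟨b, rfl⟩ := Nat.exists_eq_add_of_le' hm
  obtain rfl : k = a + b := by omega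
  have hr : capNumber (a + r) (b + r) (a + b) = r := by unfold capNumber; omega
  -- The leading powers of `N` in numerator and denominator agree; this is where the normalization
  -- `N^{-r/2}` of `gamma` is the right one.
  have hexp : r + (a + b) + triNum (a + r) + triNum (b + r) + triNum (a + b)
      = triNum r + triNum a + triNum b + triNum (a + b + r + 1) := by
    have h1 : triNum 1 = 0 := rfl
    simp only [triNum_add, h1]
    ring
  have key := ((((nearOne_qInt (a + b)).mul (nearOne_qFactorial (a + r))).mul
    (nearOne_qFactorial (b + r))).mul (nearOne_qFactorial (a + b))).mul
    ((((nearOne_qFactorial r).mul (nearOne_qFactorial a)).mul (nearOne_qFactorial b)).mul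
      (nearOne_qFactorial (a + b + r + 1))).inv
  refine key.congr ?_
  filter_upwards [eventually_ge_atTop 1] with N hN
  have hN0 : (N : ℝ) ≠ 0 := by positivity
  have hpow : (N : ℝ) ^ r * (N : ℝ) ^ (a + b) * (N : ℝ) ^ triNum (a + r) * (N : ℝ) ^ triNum (b + r)
      * (N : ℝ) ^ triNum (a + b) = (N : ℝ) ^ triNum r * (N : ℝ) ^ triNum a * (N : ℝ) ^ triNum b
      * (N : ℝ) ^ triNum (a + b + r + 1) := by
    simp only [← pow_add, hexp]
  simp only [thetaNet, hr, Nat.add_sub_cancel]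
  have hA : (N : ℝ) ^ (a + b) * (N : ℝ) ^ triNum (a + r) * (N : ℝ) ^ triNum (b + r)
      * (N : ℝ) ^ triNum (a + b) ≠ 0 := by positivity
  have hC : ((N : ℝ) ^ triNum r * (N : ℝ) ^ triNum a * (N : ℝ) ^ triNum b
      * (N : ℝ) ^ triNum (a + b + r + 1)) / ((N : ℝ) ^ (a + b) * (N : ℝ) ^ triNum (a + r)
      * (N : ℝ) ^ triNum (b + r) * (N : ℝ) ^ triNum (a + b)) = (N : ℝ) ^ r := by
    rw [div_eq_iff hA, ← hpow]
    ring
  rw [← hC]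
  simp only [div_eq_mul_inv, mul_inv, inv_inv]
  ring

/-- For `t ≥ 0`, `t - 1 = (√t - 1)(√t + 1)` with second factor at least 1. For `t < 0` the default
value `√t = 0` still fits, so the sign of the scalar need not be checked. -/
lemma abs_sqrt_sub_one_le (t : ℝ) : |Real.sqrt t - 1| ≤ |t - 1| := by
  rcases le_or_gt 0 t with ht | ht
  · have h1 : t - 1 = (Real.sqrt t - 1) * (Real.sqrt t + 1) := by
      nlinarith [Real.sq_sqrt ht]
    have h2 := Real.sqrt_nonneg t
    rw [h1, abs_mul, abs_of_nonneg (by linarith : 0 ≤ Real.sqrt t + 1)]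
    nlinarith [abs_nonneg (Real.sqrt t - 1)]
  · rw [Real.sqrt_eq_zero_of_nonpos ht.le, abs_of_neg (by linarith : t - 1 < 0)]
    norm_num
    linarith

/-! ## Operators on one tensor factor -/

/-- The vector `(id ⊗ ⟨q|) y`. -/
def sliceLeft (q : Fin m → Fin N) (y : TensorPow₂ N l m) : TensorPow N l :=
  WithLp.toLp 2 fun p => y (p, q)

/-- The vector `(⟨p| ⊗ id) y`. -/
def sliceRight (p : Fin l → Fin N) (y : TensorPow₂ N l m) : TensorPow N m :=
  WithLp.toLp 2 fun q => y (p, q)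

lemma norm_sq_eq_sum_sliceLeft (y : TensorPow₂ N l m) : ‖y‖ ^ 2 = ∑ q, ‖sliceLeft q y‖ ^ 2 := by
  simp only [EuclideanSpace.norm_sq_eq, Fintype.sum_prod_type_right, sliceLeft]

lemma norm_sq_eq_sum_sliceRight (y : TensorPow₂ N l m) : ‖y‖ ^ 2 = ∑ p, ‖sliceRight p y‖ ^ 2 := by
  simp only [EuclideanSpace.norm_sq_eq, Fintype.sum_prod_type, sliceRight]

lemma sliceLeft_tensorOp (A : TensorPow N l →L[ℂ] TensorPow N l) (q : Fin m → Fin N)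
    (y : TensorPow₂ N l m) : sliceLeft q (tensorOp A 1 y) = A (sliceLeft q y) := by
  obtain ⟨M, rfl⟩ : ∃ M, Matrix.toEuclideanCLM (𝕜 := ℂ) M = A := ⟨_, StarAlgEquiv.apply_symm_apply _ A⟩
  ext p
  simp only [sliceLeft, tensorOp, StarAlgEquiv.symm_apply_apply, map_one,
    Matrix.ofLp_toEuclideanCLM, Matrix.mulVec, dotProduct, Fintype.sum_prod_type,
    Matrix.kroneckerMap_apply]
  refine Finset.sum_congr rfl fun p' _ => ?_
  rw [Finset.sum_eq_single q (fun q' _ h => by simp [Matrix.one_apply_ne h.symm]) (by simp)]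
  simp

lemma sliceRight_tensorOp (B : TensorPow N m →L[ℂ] TensorPow N m) (p : Fin l → Fin N)
    (y : TensorPow₂ N l m) : sliceRight p (tensorOp 1 B y) = B (sliceRight p y) := by
  obtain ⟨M, rfl⟩ : ∃ M, Matrix.toEuclideanCLM (𝕜 := ℂ) M = B := ⟨_, StarAlgEquiv.apply_symm_apply _ B⟩
  ext q
  simp only [sliceRight, tensorOp, StarAlgEquiv.symm_apply_apply, map_one,
    Matrix.ofLp_toEuclideanCLM, Matrix.mulVec, dotProduct, Fintype.sum_prod_type_right,
    Matrix.kroneckerMap_apply]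
  refine Finset.sum_congr rfl fun q' _ => ?_
  rw [Finset.sum_eq_single p (fun p' _ h => by simp [Matrix.one_apply_ne h.symm]) (by simp)]
  simp

lemma tensorOp_eq_comp (A : TensorPow N l →L[ℂ] TensorPow N l)
    (B : TensorPow N m →L[ℂ] TensorPow N m) (y : TensorPow₂ N l m) :
    tensorOp A B y = tensorOp A 1 (tensorOp 1 B y) := by
  rw [← mul_apply_eq_comp]
  simp only [tensorOp, map_one]
  rw [← map_mul, ← Matrix.mul_kronecker_mul, mul_one, one_mul]

lemma sliceLeft_sub (q : Fin m → Fin N) (y y' : TensorPow₂ N l m) :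
    sliceLeft q (y - y') = sliceLeft q y - sliceLeft q y' := rfl

lemma sliceRight_sub (p : Fin l → Fin N) (y y' : TensorPow₂ N l m) :
    sliceRight p (y - y') = sliceRight p y - sliceRight p y' := rfl

lemma norm_tensorOp_proj_le (y : TensorPow₂ N l m) : ‖tensorOp (proj N l) 1 y‖ ≤ ‖y‖ := by
  refine le_of_sq_le_sq ?_ (norm_nonneg _)
  rw [norm_sq_eq_sum_sliceLeft, norm_sq_eq_sum_sliceLeft y]
  refine Finset.sum_le_sum fun q _ => ?_
  rw [sliceLeft_tensorOp]
  gcongr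
  exact Submodule.norm_starProjection_apply_le _ _

lemma norm_tensorOp_proj_right_le (y : TensorPow₂ N l m) : ‖tensorOp 1 (proj N m) y‖ ≤ ‖y‖ := by
  refine le_of_sq_le_sq ?_ (norm_nonneg _)
  rw [norm_sq_eq_sum_sliceRight, norm_sq_eq_sum_sliceRight y]
  refine Finset.sum_le_sum fun q _ => ?_
  rw [sliceRight_tensorOp]
  gcongr
  exact Submodule.norm_starProjection_apply_le _ _

lemma proj_eq_one_of_lt_two (hl : l < 2) : proj N l = 1 := by
  have : irrepSpace N l = ⊤ := by
    rw [irrepSpace_eq_capKer]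
    match l with
    | 0 => rfl
    | 1 => rfl
  rw [proj, ← Submodule.starProjection_top']
  congr

/-! ## The image of the nested cups is almost invariant -/

/-- The image of `x` under the nested cups. -/
abbrev cupVec (N l m k : ℕ) (x : TensorPow N k) : TensorPow₂ N l m :=
  Matrix.toEuclideanLin (cupMatrix N l m k) x

lemma norm_sq_cupVec_le (h : k + 2 * r = l + m) (hl : r ≤ l) (hm : r ≤ m) (x : TensorPow N k) :
    ‖cupVec N l m k x‖ ^ 2 ≤ (N : ℝ) ^ r * ‖x‖ ^ 2 := by
  refine le_trans (le_of_eq ?_) (sum_norm_sq_cup_le h hl hm x)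
  rw [EuclideanSpace.norm_sq_eq]
  exact Finset.sum_congr rfl fun y _ => by rw [← toEuclideanLin_cupMatrix_apply h hl]

/-- Slice by slice, the spectral gap supplies the factor `N - 2` and the contraction estimate the
factor `N`; the `l - 1` caps account for the constant. -/
lemma dist_left_sq_le (hN : 2 ≤ N) (h : k + 2 * r = l + m) (hl : r ≤ l) (hm : r ≤ m)
    {x : TensorPow N k} (hx : x ∈ capKer N k) :
    (N : ℝ) * (N - 2) * ‖cupVec N l m k x - tensorOp (proj N l) 1 (cupVec N l m k x)‖ ^ 2
      ≤ l * ((N : ℝ) ^ r * ‖x‖ ^ 2) := by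
  rw [norm_sq_eq_sum_sliceLeft]
  simp only [sliceLeft_sub, sliceLeft_tensorOp]
  rcases lt_or_ge l 2 with hl2 | hl2
  · simp only [proj_eq_one_of_lt_two hl2, one_apply_eq_self, sub_self]
    simp
    positivity
  obtain ⟨n, rfl⟩ : ∃ n, l = n + 2 := ⟨l - 2, by omega⟩
  have h1 : ((N : ℝ) - 2) * ∑ q, ‖sliceLeft q (cupVec N (n + 2) m k x)
      - proj N (n + 2) (sliceLeft q (cupVec N (n + 2) m k x))‖ ^ 2
      ≤ ∑ q, ∑ i, ‖cap N i (sliceLeft q (cupVec N (n + 2) m k x))‖ ^ 2 := by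
    rw [Finset.mul_sum]
    exact Finset.sum_le_sum fun q _ => norm_sub_starProjection_sq_le _
  have h2 : ∀ i : Fin (n + 1), (N : ℝ) * ∑ q, ‖cap N i (sliceLeft q (cupVec N (n + 2) m k x))‖ ^ 2
      ≤ (N : ℝ) ^ r * ‖x‖ ^ 2 := by
    intro i
    refine le_trans (le_of_eq ?_) (sum_norm_sq_cap_left_le h hl hm hx i)
    simp only [EuclideanSpace.norm_sq_eq, cap_apply, sliceLeft, cupVec,
      toEuclideanLin_cupMatrix_apply h hl]
  have h3 : (N : ℝ) * ∑ q, ∑ i, ‖cap N i (sliceLeft q (cupVec N (n + 2) m k x))‖ ^ 2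
      ≤ ((n + 1 : ℕ) : ℝ) * ((N : ℝ) ^ r * ‖x‖ ^ 2) := by
    rw [Finset.sum_comm, Finset.mul_sum]
    refine (Finset.sum_le_sum fun i _ => h2 i).trans_eq ?_
    simp
  have h4 : (0 : ℝ) ≤ (N : ℝ) ^ r * ‖x‖ ^ 2 := by positivity
  push_cast at h3 ⊢
  rw [mul_assoc]
  nlinarith [mul_le_mul_of_nonneg_left h1 (Nat.cast_nonneg (α := ℝ) N)]

lemma dist_right_sq_le (hN : 2 ≤ N) (h : k + 2 * r = l + m) (hl : r ≤ l) (hm : r ≤ m)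
    {x : TensorPow N k} (hx : x ∈ capKer N k) :
    (N : ℝ) * (N - 2) * ‖cupVec N l m k x - tensorOp 1 (proj N m) (cupVec N l m k x)‖ ^ 2
      ≤ m * ((N : ℝ) ^ r * ‖x‖ ^ 2) := by
  rw [norm_sq_eq_sum_sliceRight]
  simp only [sliceRight_sub, sliceRight_tensorOp]
  rcases lt_or_ge m 2 with hm2 | hm2
  · simp only [proj_eq_one_of_lt_two hm2, one_apply_eq_self, sub_self]
    simp
    positivity
  obtain ⟨n, rfl⟩ : ∃ n, m = n + 2 := ⟨m - 2, by omega⟩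
  have h1 : ((N : ℝ) - 2) * ∑ p, ‖sliceRight p (cupVec N l (n + 2) k x)
      - proj N (n + 2) (sliceRight p (cupVec N l (n + 2) k x))‖ ^ 2
      ≤ ∑ p, ∑ i, ‖cap N i (sliceRight p (cupVec N l (n + 2) k x))‖ ^ 2 := by
    rw [Finset.mul_sum]
    exact Finset.sum_le_sum fun q _ => norm_sub_starProjection_sq_le _
  have h2 : ∀ i : Fin (n + 1), (N : ℝ) * ∑ p, ‖cap N i (sliceRight p (cupVec N l (n + 2) k x))‖ ^ 2
      ≤ (N : ℝ) ^ r * ‖x‖ ^ 2 := by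
    intro i
    refine le_trans (le_of_eq ?_) (sum_norm_sq_cap_right_le h hl hm hx i)
    simp only [EuclideanSpace.norm_sq_eq, cap_apply, sliceRight, cupVec,
      toEuclideanLin_cupMatrix_apply h hl]
  have h3 : (N : ℝ) * ∑ p, ∑ i, ‖cap N i (sliceRight p (cupVec N l (n + 2) k x))‖ ^ 2
      ≤ ((n + 1 : ℕ) : ℝ) * ((N : ℝ) ^ r * ‖x‖ ^ 2) := by
    rw [Finset.sum_comm, Finset.mul_sum]
    refine (Finset.sum_le_sum fun i _ => h2 i).trans_eq ?_
    simp
  have h4 : (0 : ℝ) ≤ (N : ℝ) ^ r * ‖x‖ ^ 2 := by positivity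
  push_cast at h3 ⊢
  rw [mul_assoc]
  nlinarith [mul_le_mul_of_nonneg_left h1 (Nat.cast_nonneg (α := ℝ) N)]

/-- Passage from the estimates of squares to an estimate of norms. -/
lemma le_of_mul_sq_le {M d c R X : ℝ} (hM : 4 ≤ M) (hc : 0 ≤ c) (hR : 0 ≤ R) (hX : 0 ≤ X)
    (h : M * (M - 2) * d ^ 2 ≤ c * (R ^ 2 * X ^ 2)) : d ≤ (2 * c + 1) * (R * X / M) := by
  have hM0 : 0 < M := by linarith
  refine le_of_sq_le_sq ?_ (by positivity)
  have h1 : d ^ 2 * M ^ 2 ≤ 2 * c * (R * X) ^ 2 := by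
    have h0 : M * M * d ^ 2 ≤ 2 * (M * (M - 2)) * d ^ 2 :=
      mul_le_mul_of_nonneg_right (by nlinarith) (sq_nonneg d)
    rw [mul_pow]
    linarith
  have h2 : d ^ 2 ≤ 2 * c * (R * X / M) ^ 2 := by
    rw [div_pow, mul_div_assoc', le_div_iff₀ (by positivity)]
    exact h1
  -- A crude bound that keeps the constant free of square roots.
  have h3 : 2 * c ≤ (2 * c + 1) ^ 2 := by nlinarith
  rw [mul_pow]
  exact h2.trans (mul_le_mul_of_nonneg_right h3 (sq_nonneg _))

lemma norm_tensorOp_cupVec_sub_le (hN : 4 ≤ N) (h : k + 2 * r = l + m) (hl : r ≤ l) (hm : r ≤ m)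
    {x : TensorPow N k} (hx : x ∈ capKer N k) :
    ‖tensorOp (proj N l) (proj N m) (cupVec N l m k x) - cupVec N l m k x‖
      ≤ (2 * l + 2 * m + 2) * (Real.sqrt ((N : ℝ) ^ r) * ‖x‖ / N) := by
  have hN' : (4 : ℝ) ≤ N := by exact_mod_cast hN
  have hR : Real.sqrt ((N : ℝ) ^ r) ^ 2 = (N : ℝ) ^ r := Real.sq_sqrt (by positivity)
  have h1 := le_of_mul_sq_le hN' (Nat.cast_nonneg l) (Real.sqrt_nonneg _) (norm_nonneg x)
    ((dist_left_sq_le (by omega) h hl hm hx).trans_eq (by rw [hR]))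
  have h2 := le_of_mul_sq_le hN' (Nat.cast_nonneg m) (Real.sqrt_nonneg _) (norm_nonneg x)
    ((dist_right_sq_le (by omega) h hl hm hx).trans_eq (by rw [hR]))
  rw [tensorOp_eq_comp]
  set y := cupVec N l m k x
  -- Telescoping through one projection at a time; the outer one is a contraction, so the two
  -- distances add.
  have h3 : tensorOp (proj N l) 1 (tensorOp 1 (proj N m) y) - y
      = -(tensorOp (proj N l) 1 (y - tensorOp 1 (proj N m) y))
        - (y - tensorOp (proj N l) 1 y) := by
    rw [map_sub]; abel
  rw [h3]
  refine (norm_sub_le _ _).trans ?_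
  rw [norm_neg]
  refine (add_le_add ((norm_tensorOp_proj_le _).trans h2) h1).trans_eq ?_
  ring

lemma norm_tensorOp_cupVec_le (h : k + 2 * r = l + m) (hl : r ≤ l) (hm : r ≤ m)
    (x : TensorPow N k) :
    ‖tensorOp (proj N l) (proj N m) (cupVec N l m k x)‖ ≤ Real.sqrt ((N : ℝ) ^ r) * ‖x‖ := by
  rw [tensorOp_eq_comp]
  refine (norm_tensorOp_proj_le _).trans ((norm_tensorOp_proj_right_le _).trans ?_)
  refine le_of_sq_le_sq ?_ (by positivity)
  rw [mul_pow, Real.sq_sqrt (by positivity)]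
  exact norm_sq_cupVec_le h hl hm x

/-! ### Combination of the scalar and the operator estimates -/

lemma norm_alpha_sub_gamma_le (hN : 4 ≤ N) (h : k + 2 * r = l + m) (hl : r ≤ l) (hm : r ≤ m) :
    ‖alpha N l m k - gamma N l m k‖
      ≤ |qInt N (k + 1) / thetaNet N k l m * (N : ℝ) ^ r - 1| + (2 * l + 2 * m + 2) * (N : ℝ)⁻¹ := by
  have hr : capNumber l m k = r := by unfold capNumber; omega
  have hN0 : (0 : ℝ) < N := by positivity
  set R := Real.sqrt ((N : ℝ) ^ r) with hRdef
  have hR : 0 < R := Real.sqrt_pos.2 (by positivity)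
  set s := Real.sqrt (qInt N (k + 1) / thetaNet N k l m) with hs
  have hgam : (N : ℝ) ^ (-((r : ℝ) / 2)) = R⁻¹ := by
    rw [hRdef, Real.sqrt_eq_rpow, Real.rpow_neg hN0.le, ← Real.rpow_natCast, ← Real.rpow_mul hN0.le]
    congr 2
    ring
  refine ContinuousLinearMap.opNorm_le_bound _ (by positivity) fun x => ?_
  have hx : (x : TensorPow N k) ∈ capKer N k := by
    rw [← irrepSpace_eq_capKer]; exact x.2
  have h1 : (alpha N l m k - gamma N l m k) x
      = ((s - R⁻¹ : ℝ) : ℂ) • tensorOp (proj N l) (proj N m) (cupVec N l m k x)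
        + ((R⁻¹ : ℝ) : ℂ) • (tensorOp (proj N l) (proj N m) (cupVec N l m k x)
          - cupVec N l m k x) := by
    have hg : gamma N l m k x = ((R⁻¹ : ℝ) : ℂ) • cupVec N l m k x := by
      rw [gamma, hr, hgam]; rfl
    have ha : alpha N l m k x
        = ((s : ℝ) : ℂ) • tensorOp (proj N l) (proj N m) (cupVec N l m k x) := rfl
    rw [_root_.sub_apply, hg, ha]
    push_cast
    module
  rw [h1]
  refine (norm_add_le _ _).trans ?_
  rw [norm_smul, norm_smul, Complex.norm_real, Complex.norm_real, Real.norm_eq_abs,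
    Real.norm_of_nonneg (inv_nonneg.2 hR.le)]
  -- `s R` is the square root of the scalar that is close to 1, since `R² = N^r`.
  have h2 : |s - R⁻¹| * R ≤ |qInt N (k + 1) / thetaNet N k l m * (N : ℝ) ^ r - 1| := by
    refine le_trans (le_of_eq ?_) (abs_sqrt_sub_one_le _)
    rw [Real.sqrt_mul' _ (by positivity), ← hs, ← hRdef]
    nth_rewrite 2 [← abs_of_pos hR]
    rw [← abs_mul, sub_mul, inv_mul_cancel₀ hR.ne']
  rw [add_mul]
  refine add_le_add ?_ ?_
  · calc _ ≤ |s - R⁻¹| * (R * ‖(x : TensorPow N k)‖) :=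
          mul_le_mul_of_nonneg_left (norm_tensorOp_cupVec_le h hl hm _) (abs_nonneg _)
      _ = (|s - R⁻¹| * R) * ‖x‖ := by rw [mul_assoc, Submodule.coe_norm]
      _ ≤ _ := mul_le_mul_of_nonneg_right h2 (norm_nonneg _)
  · calc _ ≤ R⁻¹ * ((2 * l + 2 * m + 2) * (R * ‖(x : TensorPow N k)‖ / N)) :=
          mul_le_mul_of_nonneg_left (norm_tensorOp_cupVec_sub_le hN h hl hm hx)
            (inv_nonneg.2 hR.le)
      _ = _ := by
          rw [Submodule.coe_norm]
          field_simp

lemma IsAdmissible.capNumber_spec (h : IsAdmissible l m k) :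
    k + 2 * capNumber l m k = l + m ∧ capNumber l m k ≤ l ∧ capNumber l m k ≤ m := by
  obtain ⟨i, hi, hk⟩ := h
  unfold capNumber
  rcases le_total (l : ℤ) m with hlm | hlm
  · rw [abs_of_nonpos (by omega)] at hi
    omega
  · rw [abs_of_nonneg (by omega)] at hi
    omega

end FreeOrthogonal

end

theorem theorem1 (l m k : ℕ) (h : FreeOrthogonal.IsAdmissible l m k) :
    (fun N : ℕ => ‖FreeOrthogonal.alpha N l m k - FreeOrthogonal.gamma N l m k‖)
      =O[atTop] (fun N : ℕ => ((N : ℝ))⁻¹) := by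
  obtain ⟨h1, hl, hm⟩ := h.capNumber_spec
  have h2 := (FreeOrthogonal.nearOne_scalar h1 hl hm).norm_left.add
    ((isBigO_refl (fun N : ℕ => (N : ℝ)⁻¹) atTop).const_mul_left (2 * l + 2 * m + 2))
  refine IsBigO.trans (IsBigO.of_bound 1 ?_) h2
  -- From `N = 4` on, `N² ≤ 2 N (N - 2)`, so the gap `N - 2` may be replaced by `N` up to a
  -- constant.
  filter_upwards [eventually_ge_atTop 4] with N hN
  rw [Real.norm_of_nonneg (ContinuousLinearMap.opNorm_nonneg _), one_mul]
  exact (FreeOrthogonal.norm_alpha_sub_gamma_le hN h1 hl hm).trans (le_abs_self _)
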